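/- Let $1<\gamma<3$, $b:=-\frac{3-\gamma}{2(\gamma-1)}<0$, and let $I=[x_B,x_C]$ with $x_B<x_C$, or $I=[x_B,\infty)$. Let $a\in C^2(I)$ with $a>0$ and $a'\ge 0$ on $I$, and put $k:=a'/a$. Assume that $k\in C^1(I)$ has a bounded $C^1$ norm and that, for some $\delta\in(0,2)$, $$k'(x)\le \frac{k(x)^2}{(2-\delta)b}\qquad(x\in I).$$ For a parameter $\nu>0$ consider the initial-boundary value problem for the Riemann invariants $$\begin{cases} S_t+\lambda_1S_x=g,\quad R_t+\lambda_2R_x=-g, & x\in\mathring I,\ t>0,\\ S(x,0)=S_0(x),\quad R(x,0)=R_0(x), & x\in I,\\ S(x_B,t)=S_B(t),\quad R(x_B,t)=R_B(t), & t\ge0,\end{cases}$$ where $\lambda_1=\frac{\gamma+1}{4}S+\frac{3-\gamma}{4}R$, $\lambda_2=\frac{3-\gamma}{4}S+\frac{\gamma+1}{4}R$, $g=\frac{\gamma-1}{8}k(x)(R^2-S^2)$. The velocity and the density are recovered by $$v=\frac{S+R}{2},\qquad \rho=\Big(\frac{\gamma-1}{16\nu}\Big)^{\frac1{\gamma-1}}(R-S)^{\frac2{\gamma-1}}.$$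 Let $C,M$ be real constants. Then there is $\nu_*>0$, depending only on $\gamma,I,a,\delta,C,M$, such that the following holds for every $\nu\in(0,\nu_*]$ and all data $S_0,R_0,S_B,R_B$ which satisfy, with $\xi_0:=R_0/S_0-1$, $\xi_B:=R_B/S_B-1$, $\epsilon_0:=\ln(S_0\xi_0)$, $\epsilon_B:=\ln(S_B\xi_B)$, the following conditions. 1. $S_0,R_0\in C^1(I)$ and $S_B,R_B\in C^1([0,\infty))$ have bounded $C^1$ norms; $0<S_0<R_0\le M$ on $I$ and $0<S_B<R_B\le M$ on $[0,\infty)$. 2. $S_0(x_B)=S_B(0)$, $R_0(x_B)=R_B(0)$, and, with $\lambda_1,\lambda_2,g$ evaluated at $x=x_B$, $S=S_0(x_B)$, $R=R_0(x_B)$: $S_B'(0)+\lambda_1S_0'(x_B)=g$ and $R_B'(0)+\lambda_2R_0'(x_B)=-g$. 3. $S_0'\ge0$, $R_0'\ge0$, $\xi_0\le C\sqrt\nu$ on $I$, and $S_B'\le0$, $R_B'\le0$, $\xi_B\le C\sqrt\nu$ on $[0,\infty)$. 4. For all $x\in I$: if $b\ne-1$, $$\tfrac{kS_0}{2}\Big(\tfrac1{-b}-\tfrac{1}{b+1}\xi_0\Big)\le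 S_0',\qquad \tfrac{kS_0}{2}\Big(\tfrac1{-b}-\tfrac{1}{b(b+1)}\xi_0\Big)\le R_0';$$ if $b=-1$, $$\tfrac{kS_0}{2}\big(1-\epsilon_0\xi_0\big)\le S_0',\qquad \tfrac{kS_0}{2}\big(1+\xi_0+\epsilon_0\xi_0\big)\le R_0'.$$ 5. For all $t\ge0$: if $b\neq-1$, $$S_B'\le\tfrac{k(x_B)S_B^2}{2}\Big(\tfrac1b+\tfrac1{b+1}\xi_B+\tfrac{1-b}{2(b+1)(1-2b)}\xi_B^2\Big),\qquad R_B'\le\tfrac{k(x_B)S_B^2}{2}\Big(\tfrac1b+\tfrac{b+2}{b(b+1)}\xi_B-\tfrac{b^2+3b-2}{2b(b+1)(1-2b)}\xi_B^2\Big);$$ if $b=-1$, $$S_B'\le\tfrac{k(x_B)S_B^2}{2}\Big(-1+\epsilon_B\xi_B+\tfrac{2\epsilon_B+1}{6}\xi_B^2\Big),\qquad R_B'\le\tfrac{k(x_B)S_B^2}{2}\Big(-1-(\epsilon_B+2)\xi_B-\tfrac{4\epsilon_B+5}{6}\xi_B^2\Big).$$ Let $(S,R)$ be a global solution of the problem,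 of class $C^1$ on $I\times[0,\infty)$. Then: (i) For every $x\in I$ with $k(x)>0$, the functions $t\mapsto S(x,t),R(x,t),v(x,t)$ are nonincreasing on $[0,\infty)$ and tend to $0$ as $t\to\infty$, and $\rho(x,t)\to0$ as $t\to\infty$. Moreover $S(x,t)$, $R(x,t)$, $v(x,t)$ and $\rho(x,t)^{(\gamma-1)/2}$ are $O(1/t)$ as $t\to\infty$. (ii) For every $x_*\in I$ with $k(x_*)>0$, the convergence of $S,R,v,\rho$ to $0$ as $t\to\infty$ is uniform on $[x_B,x_*]$, and so are the rates: there is a constant $K$ with $|S|,|R|,|v|,\rho^{(\gamma-1)/2}\le K/t$ on $[x_B,x_*]\times[1,\infty)$. -/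

import Mathlib

open Set Filter Topology Asymptotics

noncomputable section

namespace DuctFlow

/-- The spatial domain: `[x_B, x_C]` with `x_B < x_C`, or `[x_B, ∞)`. -/
def IsDuctInterval (xB : ℝ) (I : Set ℝ) : Prop :=
  (∃ xC : ℝ, xB < xC ∧ I = Icc xB xC) ∨ I = Ici xB

/-- `f` is `C¹` on `s` (one-sided derivatives at the end points that belong to `s`) and its
`C¹` norm on `s` is finite. -/
def BoundedC1On (f : ℝ → ℝ) (s : Set ℝ) : Prop :=
  ContDiffOn ℝ 1 f s ∧ ∃ K : ℝ, ∀ x ∈ s, |f x| ≤ K ∧ |derivWithin f s x| ≤ K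

/-- A divergent duct: the cross-sectional area `a` is `C²` on `I`, positive, with `a' ≥ 0`. -/
structure IsDivergentDuct (I : Set ℝ) (a : ℝ → ℝ) : Prop where
  contDiffOn : ContDiffOn ℝ 2 a I
  pos : ∀ x ∈ I, 0 < a x
  deriv_nonneg : ∀ x ∈ I, 0 ≤ derivWithin a I x

/-- The shape function `k = a' / a` of the duct. -/
def shape (I : Set ℝ) (a : ℝ → ℝ) (x : ℝ) : ℝ := derivWithin a I x / a x

/-- The exponent `b = -(3 - γ) / (2 (γ - 1))`, negative for `1 < γ < 3`; `b = -1` iff `γ = 5/3`. -/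
def expB (γ : ℝ) : ℝ := -((3 - γ) / (2 * (γ - 1)))

/-- First characteristic speed, in terms of the values of the Riemann invariants. -/
def speed1 (γ S R : ℝ) : ℝ := (γ + 1) / 4 * S + (3 - γ) / 4 * R

/-- Second characteristic speed, in terms of the values of the Riemann invariants. -/
def speed2 (γ S R : ℝ) : ℝ := (3 - γ) / 4 * S + (γ + 1) / 4 * R

/-- The source term `g = (γ - 1) / 8 * k * (R² - S²)`, where `κ` is the value of `k`. -/
def source (γ κ S R : ℝ) : ℝ := (γ - 1) / 8 * κ * (R ^ 2 - S ^ 2)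

/-- The variable `ξ = R / S - 1`. -/
def xi (S R : ℝ) : ℝ := R / S - 1

/-- The variable `ε = ln (S ξ)`. -/
def eps (S R : ℝ) : ℝ := Real.log (S * xi S R)

/-- Velocity in terms of the Riemann invariants. -/
def velocity (S R : ℝ) : ℝ := (S + R) / 2

/-- (Rescaled) density in terms of the Riemann invariants; it is the inverse of
`S = v - 2 √(ν/(γ-1)) ρ^((γ-1)/2)`, `R = v + 2 √(ν/(γ-1)) ρ^((γ-1)/2)`. -/
def density (γ ν S R : ℝ) : ℝ :=
  ((γ - 1) / (16 * ν)) ^ (1 / (γ - 1)) * (R - S) ^ (2 / (γ - 1))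

/-- Compatibility of the initial and boundary data at the corner `(x_B, 0)`, up to first order. -/
structure Compatible (γ xB : ℝ) (I : Set ℝ) (k S0 R0 SB RB : ℝ → ℝ) : Prop where
  S_zero : S0 xB = SB 0
  R_zero : R0 xB = RB 0
  S_one : derivWithin SB (Ici 0) 0 + speed1 γ (S0 xB) (R0 xB) * derivWithin S0 I xB
    = source γ (k xB) (S0 xB) (R0 xB)
  R_one : derivWithin RB (Ici 0) 0 + speed2 γ (S0 xB) (R0 xB) * derivWithin R0 I xB
    = -source γ (k xB) (S0 xB) (R0 xB)

/-- The lower bounds for `S₀'` and `R₀'` on `I`. -/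
structure InitialSlopes (γ : ℝ) (I : Set ℝ) (k S0 R0 : ℝ → ℝ) : Prop where
  S_ne : expB γ ≠ -1 → ∀ x ∈ I,
    k x * S0 x / 2 * (1 / (-expB γ) - 1 / (expB γ + 1) * xi (S0 x) (R0 x))
      ≤ derivWithin S0 I x
  S_eq : expB γ = -1 → ∀ x ∈ I,
    k x * S0 x / 2 * (1 - eps (S0 x) (R0 x) * xi (S0 x) (R0 x)) ≤ derivWithin S0 I x
  R_ne : expB γ ≠ -1 → ∀ x ∈ I,
    k x * S0 x / 2 * (1 / (-expB γ) - 1 / (expB γ * (expB γ + 1)) * xi (S0 x) (R0 x))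
      ≤ derivWithin R0 I x
  R_eq : expB γ = -1 → ∀ x ∈ I,
    k x * S0 x / 2 * (1 + xi (S0 x) (R0 x) + eps (S0 x) (R0 x) * xi (S0 x) (R0 x))
      ≤ derivWithin R0 I x

/-- The upper bounds for `S_B'` and `R_B'` on `[0, ∞)`; `κ` is the value `k(x_B)`. -/
structure BoundarySlopes (γ κ : ℝ) (SB RB : ℝ → ℝ) : Prop where
  S_ne : expB γ ≠ -1 → ∀ t ∈ Ici (0 : ℝ), derivWithin SB (Ici 0) t ≤
    κ * SB t ^ 2 / 2 * (1 / expB γ + 1 / (expB γ + 1) * xi (SB t) (RB t)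
      + (1 - expB γ) / (2 * (expB γ + 1) * (1 - 2 * expB γ)) * xi (SB t) (RB t) ^ 2)
  S_eq : expB γ = -1 → ∀ t ∈ Ici (0 : ℝ), derivWithin SB (Ici 0) t ≤
    κ * SB t ^ 2 / 2 * (-1 + eps (SB t) (RB t) * xi (SB t) (RB t)
      + (2 * eps (SB t) (RB t) + 1) / 6 * xi (SB t) (RB t) ^ 2)
  R_ne : expB γ ≠ -1 → ∀ t ∈ Ici (0 : ℝ), derivWithin RB (Ici 0) t ≤
    κ * SB t ^ 2 / 2 * (1 / expB γ + (expB γ + 2) / (expB γ * (expB γ + 1)) * xi (SB t) (RB t)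
      - (expB γ ^ 2 + 3 * expB γ - 2) / (2 * expB γ * (expB γ + 1) * (1 - 2 * expB γ))
        * xi (SB t) (RB t) ^ 2)
  R_eq : expB γ = -1 → ∀ t ∈ Ici (0 : ℝ), derivWithin RB (Ici 0) t ≤
    κ * SB t ^ 2 / 2 * (-1 - (eps (SB t) (RB t) + 2) * xi (SB t) (RB t)
      - (4 * eps (SB t) (RB t) + 5) / 6 * xi (SB t) (RB t) ^ 2)

/-- The conditions on the initial data `S₀, R₀` and the boundary data `S_B, R_B`.
`C` is the constant in `ξ₀ = O(√ν)` and `ξ_B = O(√ν)`; `M` bounds the data (recall `0 < S < R`). -/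
structure AdmissibleData (γ xB : ℝ) (I : Set ℝ) (k : ℝ → ℝ) (ν C M : ℝ)
    (S0 R0 SB RB : ℝ → ℝ) : Prop where
  compatible : Compatible γ xB I k S0 R0 SB RB
  S0_C1 : BoundedC1On S0 I
  R0_C1 : BoundedC1On R0 I
  initial_pos : ∀ x ∈ I, 0 < S0 x ∧ S0 x < R0 x
  initial_le : ∀ x ∈ I, R0 x ≤ M
  SB_C1 : BoundedC1On SB (Ici 0)
  RB_C1 : BoundedC1On RB (Ici 0)
  boundary_pos : ∀ t ∈ Ici (0 : ℝ), 0 < SB t ∧ SB t < RB t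
  boundary_le : ∀ t ∈ Ici (0 : ℝ), RB t ≤ M
  initial_mono : ∀ x ∈ I, 0 ≤ derivWithin S0 I x ∧ 0 ≤ derivWithin R0 I x
  initial_xi : ∀ x ∈ I, xi (S0 x) (R0 x) ≤ C * √ν
  boundary_anti : ∀ t ∈ Ici (0 : ℝ),
    derivWithin SB (Ici 0) t ≤ 0 ∧ derivWithin RB (Ici 0) t ≤ 0
  boundary_xi : ∀ t ∈ Ici (0 : ℝ), xi (SB t) (RB t) ≤ C * √ν
  initial_slopes : InitialSlopes γ I k S0 R0
  boundary_slopes : BoundarySlopes γ (k xB) SB RB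

/-- `(S, R)` is a `C¹` solution on `I × [0, ∞)` of the initial-boundary value problem for the
Riemann invariants. -/
structure IsGlobalC1Solution (γ xB : ℝ) (I : Set ℝ) (k S0 R0 SB RB : ℝ → ℝ)
    (S R : ℝ → ℝ → ℝ) : Prop where
  S_C1 : ContDiffOn ℝ 1 (fun p : ℝ × ℝ => S p.1 p.2) (I ×ˢ Ici (0 : ℝ))
  R_C1 : ContDiffOn ℝ 1 (fun p : ℝ × ℝ => R p.1 p.2) (I ×ˢ Ici (0 : ℝ))
  S_eq : ∀ x ∈ interior I, ∀ t : ℝ, 0 < t →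
    deriv (fun s => S x s) t + speed1 γ (S x t) (R x t) * deriv (fun y => S y t) x
      = source γ (k x) (S x t) (R x t)
  R_eq : ∀ x ∈ interior I, ∀ t : ℝ, 0 < t →
    deriv (fun s => R x s) t + speed2 γ (S x t) (R x t) * deriv (fun y => R y t) x
      = -source γ (k x) (S x t) (R x t)
  initial : ∀ x ∈ I, S x 0 = S0 x ∧ R x 0 = R0 x
  boundary : ∀ t ∈ Ici (0 : ℝ), S xB t = SB t ∧ R xB t = RB t

end DuctFlow

end

/-! While `0 < S < R` both characteristic speeds are positive, so information only travels to the
right. Everything at a point is decided by the initial data and by the data at `xB`, and nothing is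
needed at the right end of a truncated strip. The order `0 < S < R`, the monotonicity in time and
the decay are therefore all obtained by comparison with explicit barriers, through the single
maximum principle `neg_of_transport`.

For the order (`pos_lt`), the source is nonnegative and `R - S` satisfies a linear homogeneous
transport equation, so exponentially small lower barriers suffice. For monotonicity
(`deriv_t_nonpos`), the slope conditions and the equations make the time derivatives nonpositive at
`t = 0`, and the boundary data are nonincreasing. Solutions are only `C¹`, so the sign is propagated
through difference quotients in time. Their linear system need not be cooperative everywhere, but
its coupling coefficients are nonnegative at any point where a quotient reaches a positive barrier,
and only such points matter.

For decay, a small `ν` makes the `ξ`-corrections harmless, and the slope condition at the boundary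
becomes `S_B' ≤ -κ S_B²` with `κ > 0` when `k(xB) > 0`. Hence `S_B`, and with it `R_B ≤ 2 S_B`, is
`O(1/t)`. The barrier `(A (x - xB) + Q + 1) / t` carries this bound into the duct
(`le_div_of_boundary`), with a constant that is affine in `x` and so uniform on `[xB, xs]`. The
condition on `k'` makes `k` nonincreasing, so positivity of `k` at any point gives `k(xB) > 0`. -/

namespace DuctFlow

/-! ### Maximum principle for transport to the right -/

/-- A one-sided derivative at the right end of an interval where the function is maximal. -/
theorem nonneg_of_hasDerivWithinAt_of_le {φ : ℝ → ℝ} {d p q r : ℝ} (hpq : p < q) (hqr : q ≤ r)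
    (hφ : HasDerivWithinAt φ d (Icc p r) q) (hle : ∀ y ∈ Ico p q, φ y ≤ φ q) : 0 ≤ d := by
  have h1 : HasDerivWithinAt φ d (Ico p q) q :=
    hφ.mono fun y hy => ⟨hy.1, hy.2.le.trans hqr⟩
  rw [hasDerivWithinAt_iff_tendsto_slope' (by simp)] at h1
  have : (𝓝[Ico p q] q).NeBot := by
    rw [nhdsWithin_Ico_eq_nhdsLT hpq]; infer_instance
  refine ge_of_tendsto h1 ?_
  filter_upwards [self_mem_nhdsWithin] with y hy
  rw [slope_def_field]
  exact div_nonneg_of_nonpos (by linarith [hle y hy]) (by linarith [hy.2])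

/-- Maximum principle for a pair of functions transported to the right: they stay negative if they
are negative at the initial time and at the left end, and if each of them strictly decreases along
some nonnegative speed whenever it vanishes while the other one is nonpositive. -/
theorem neg_of_transport {xB X t₀ T : ℝ} {f g fx ft gx gt : ℝ → ℝ → ℝ}
    (hf : ContinuousOn (fun p : ℝ × ℝ => f p.1 p.2) (Icc xB X ×ˢ Icc t₀ T))
    (hg : ContinuousOn (fun p : ℝ × ℝ => g p.1 p.2) (Icc xB X ×ˢ Icc t₀ T))
    (h0 : ∀ x ∈ Icc xB X, f x t₀ < 0 ∧ g x t₀ < 0)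
    (hB : ∀ t ∈ Icc t₀ T, f xB t < 0 ∧ g xB t < 0)
    (hfx : ∀ x ∈ Ioc xB X, ∀ t ∈ Ioc t₀ T,
      HasDerivWithinAt (fun y => f y t) (fx x t) (Icc xB X) x)
    (hgx : ∀ x ∈ Ioc xB X, ∀ t ∈ Ioc t₀ T,
      HasDerivWithinAt (fun y => g y t) (gx x t) (Icc xB X) x)
    (hft : ∀ x ∈ Ioc xB X, ∀ t ∈ Ioc t₀ T,
      HasDerivWithinAt (fun s => f x s) (ft x t) (Icc t₀ T) t)
    (hgt : ∀ x ∈ Ioc xB X, ∀ t ∈ Ioc t₀ T,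
      HasDerivWithinAt (fun s => g x s) (gt x t) (Icc t₀ T) t)
    (hF : ∀ x ∈ Ioc xB X, ∀ t ∈ Ioc t₀ T, f x t = 0 → g x t ≤ 0 →
      ∃ c : ℝ, 0 ≤ c ∧ ft x t + c * fx x t < 0)
    (hG : ∀ x ∈ Ioc xB X, ∀ t ∈ Ioc t₀ T, g x t = 0 → f x t ≤ 0 →
      ∃ c : ℝ, 0 ≤ c ∧ gt x t + c * gx x t < 0) :
    ∀ x ∈ Icc xB X, ∀ t ∈ Icc t₀ T, f x t < 0 ∧ g x t < 0 := by
  by_contra! hcon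
  obtain ⟨x1, hx1, t1, ht1, hft1⟩ := hcon
  set m : ℝ × ℝ → ℝ := fun p => max (f p.1 p.2) (g p.1 p.2) with hm
  have hmc : ContinuousOn m (Icc xB X ×ˢ Icc t₀ T) := hf.sup hg
  have hKc : IsCompact (Icc xB X ×ˢ Icc t₀ T) := isCompact_Icc.prod isCompact_Icc
  have hK' : IsCompact ((Icc xB X ×ˢ Icc t₀ T) ∩ m ⁻¹' Ici 0) :=
    hKc.of_isClosed_subset (hmc.preimage_isClosed_of_isClosed hKc.isClosed isClosed_Ici)
      inter_subset_left
  have hne : ((Icc xB X ×ˢ Icc t₀ T) ∩ m ⁻¹' Ici 0).Nonempty := by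
    refine ⟨(x1, t1), ⟨hx1, ht1⟩, ?_⟩
    simp only [hm, mem_preimage, mem_Ici, le_max_iff]
    by_contra! h
    exact absurd (hft1 h.1) (not_le.2 h.2)
  -- First touching: a point of least time in the compact set where one of the two functions is
  -- nonnegative.
  obtain ⟨⟨x, t⟩, ⟨⟨hx, ht⟩, hmx⟩, hmin⟩ := hK'.exists_isMinOn hne continuous_snd.continuousOn
  simp only at hx ht
  have hbefore : ∀ y ∈ Icc xB X, ∀ s ∈ Ico t₀ t, m (y, s) < 0 := by
    intro y hy s hs
    by_contra! h
    have : t ≤ s := hmin (show (y, s) ∈ _ from ⟨⟨hy, hs.1, hs.2.le.trans ht.2⟩, h⟩)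
    exact absurd hs.2 (not_lt.2 this)
  have hxB : xB < x := by
    rcases hx.1.lt_or_eq with h | h
    · exact h
    · exact absurd (max_lt (hB t ht).1 (hB t ht).2) (by rw [h]; exact not_lt.2 hmx)
  have ht0 : t₀ < t := by
    rcases ht.1.lt_or_eq with h | h
    · exact h
    · exact absurd (max_lt (h0 x hx).1 (h0 x hx).2) (by rw [h]; exact not_lt.2 hmx)
  -- Letting earlier times tend to `t` bounds the whole slice. The vanishing function is thus
  -- maximal both against the past and against points to the left, and since `c ≥ 0` no other
  -- direction is needed.
  have hat : ∀ y ∈ Icc xB X, m (y, t) ≤ 0 := by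
    intro y hy
    have h1 : Tendsto (fun s => m (y, s)) (𝓝[Ico t₀ t] t) (𝓝 (m (y, t))) := by
      refine (hmc (y, t) ⟨hy, ht⟩).tendsto.comp ?_
      refine tendsto_nhdsWithin_iff.2 ⟨?_, ?_⟩
      · exact (tendsto_const_nhds.prodMk_nhds (tendsto_id.mono_left nhdsWithin_le_nhds))
      · filter_upwards [self_mem_nhdsWithin] with s hs
        exact ⟨hy, hs.1, hs.2.le.trans ht.2⟩
    have : (𝓝[Ico t₀ t] t).NeBot := by
      rw [nhdsWithin_Ico_eq_nhdsLT ht0]; infer_instance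
    refine le_of_tendsto h1 ?_
    filter_upwards [self_mem_nhdsWithin] with s hs using (hbefore y hy s hs).le
  have hf0 := (le_max_left _ _).trans (hat x hx)
  have hg0 := (le_max_right _ _).trans (hat x hx)
  simp only at hf0 hg0
  have hX : x ∈ Ioc xB X := ⟨hxB, hx.2⟩
  have hT : t ∈ Ioc t₀ T := ⟨ht0, ht.2⟩
  rcases le_max_iff.1 (show 0 ≤ max (f x t) (g x t) from hmx) with h | h
  · have hz : f x t = 0 := le_antisymm hf0 h
    obtain ⟨c, hc, hlt⟩ := hF x hX t hT hz hg0
    have h1 := nonneg_of_hasDerivWithinAt_of_le hxB hx.2 (hfx x hX t hT) fun y hy => by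
      rw [hz]; exact (le_max_left _ _).trans (hat y ⟨hy.1, hy.2.le.trans hx.2⟩)
    have h2 := nonneg_of_hasDerivWithinAt_of_le ht0 ht.2 (hft x hX t hT) fun s hs => by
      rw [hz]; exact (le_max_left _ _).trans (hbefore x hx s hs).le
    nlinarith [mul_nonneg hc h1]
  · have hz : g x t = 0 := le_antisymm hg0 h
    obtain ⟨c, hc, hlt⟩ := hG x hX t hT hz hf0
    have h1 := nonneg_of_hasDerivWithinAt_of_le hxB hx.2 (hgx x hX t hT) fun y hy => by
      rw [hz]; exact (le_max_right _ _).trans (hat y ⟨hy.1, hy.2.le.trans hx.2⟩)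
    have h2 := nonneg_of_hasDerivWithinAt_of_le ht0 ht.2 (hgt x hX t hT) fun s hs => by
      rw [hz]; exact (le_max_right _ _).trans (hbefore x hx s hs).le
    nlinarith [mul_nonneg hc h1]

/-! ### Solutions on a strip and the order of the invariants -/

/-- A classical solution on the closed strip `[xB, X] × [0, ∞)`, with its first derivatives, which
are continuous up to the boundary. -/
structure StripSolution (γ xB X : ℝ) (k : ℝ → ℝ) (S R Sx St Rx Rt : ℝ → ℝ → ℝ) : Prop where
  S_cont : ContinuousOn (fun p : ℝ × ℝ => S p.1 p.2) (Icc xB X ×ˢ Ici 0)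
  R_cont : ContinuousOn (fun p : ℝ × ℝ => R p.1 p.2) (Icc xB X ×ˢ Ici 0)
  Sx_cont : ContinuousOn (fun p : ℝ × ℝ => Sx p.1 p.2) (Icc xB X ×ˢ Ici 0)
  St_cont : ContinuousOn (fun p : ℝ × ℝ => St p.1 p.2) (Icc xB X ×ˢ Ici 0)
  Rx_cont : ContinuousOn (fun p : ℝ × ℝ => Rx p.1 p.2) (Icc xB X ×ˢ Ici 0)
  Rt_cont : ContinuousOn (fun p : ℝ × ℝ => Rt p.1 p.2) (Icc xB X ×ˢ Ici 0)
  k_cont : ContinuousOn k (Icc xB X)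
  k_nonneg : ∀ x ∈ Icc xB X, 0 ≤ k x
  S_x : ∀ x ∈ Icc xB X, ∀ t ∈ Ici (0 : ℝ),
    HasDerivWithinAt (fun y => S y t) (Sx x t) (Icc xB X) x
  S_t : ∀ x ∈ Icc xB X, ∀ t ∈ Ici (0 : ℝ),
    HasDerivWithinAt (fun s => S x s) (St x t) (Ici 0) t
  R_x : ∀ x ∈ Icc xB X, ∀ t ∈ Ici (0 : ℝ),
    HasDerivWithinAt (fun y => R y t) (Rx x t) (Icc xB X) x
  R_t : ∀ x ∈ Icc xB X, ∀ t ∈ Ici (0 : ℝ),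
    HasDerivWithinAt (fun s => R x s) (Rt x t) (Ici 0) t
  S_eq : ∀ x ∈ Icc xB X, ∀ t ∈ Ici (0 : ℝ),
    St x t + speed1 γ (S x t) (R x t) * Sx x t = source γ (k x) (S x t) (R x t)
  R_eq : ∀ x ∈ Icc xB X, ∀ t ∈ Ici (0 : ℝ),
    Rt x t + speed2 γ (S x t) (R x t) * Rx x t = -source γ (k x) (S x t) (R x t)

theorem exists_abs_le_strip {xB X T : ℝ} {f : ℝ → ℝ → ℝ}
    (hf : ContinuousOn (fun p : ℝ × ℝ => f p.1 p.2) (Icc xB X ×ˢ Ici 0)) :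
    ∃ N : ℝ, 0 ≤ N ∧ ∀ x ∈ Icc xB X, ∀ t ∈ Icc 0 T, |f x t| ≤ N := by
  obtain ⟨N, hN⟩ := (isCompact_Icc.prod isCompact_Icc).exists_bound_of_continuousOn
    (hf.mono (prod_mono_right (Icc_subset_Ici_self : Icc 0 T ⊆ Ici 0)))
  exact ⟨max N 0, le_max_right _ _, fun x hx t ht => (hN (x, t) ⟨hx, ht⟩).trans (le_max_left _ _)⟩

theorem exists_pos_lt_of_continuousOn {f : ℝ → ℝ} {p q : ℝ} (hf : ContinuousOn f (Icc p q))
    (hpos : ∀ x ∈ Icc p q, 0 < f x) : ∃ σ : ℝ, 0 < σ ∧ ∀ x ∈ Icc p q, σ < f x := by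
  rcases (Icc p q).eq_empty_or_nonempty with h | h
  · exact ⟨1, one_pos, fun x hx => absurd hx (by simp [h])⟩
  · obtain ⟨x, hx, hmin⟩ := isCompact_Icc.exists_isMinOn h hf
    exact ⟨f x / 2, half_pos (hpos x hx), fun y hy => by
      have : f x ≤ f y := hmin hy
      linarith [hpos x hx]⟩

theorem speed1_nonneg {γ S R : ℝ} (hγ1 : 1 < γ) (hγ3 : γ < 3) (hS : 0 ≤ S) (hR : 0 ≤ R) :
    0 ≤ speed1 γ S R := by
  unfold speed1
  have := mul_nonneg (show 0 ≤ (γ + 1) / 4 by linarith) hS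
  have := mul_nonneg (show 0 ≤ (3 - γ) / 4 by linarith) hR
  linarith

theorem speed2_nonneg {γ S R : ℝ} (hγ1 : 1 < γ) (hγ3 : γ < 3) (hS : 0 ≤ S) (hR : 0 ≤ R) :
    0 ≤ speed2 γ S R := by
  unfold speed2
  have := mul_nonneg (show 0 ≤ (γ + 1) / 4 by linarith) hR
  have := mul_nonneg (show 0 ≤ (3 - γ) / 4 by linarith) hS
  linarith

theorem source_nonneg {γ κ S R : ℝ} (hγ1 : 1 < γ) (hκ : 0 ≤ κ) (hS : 0 ≤ S) (hR : S ≤ R) :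
    0 ≤ source γ κ S R := by
  unfold source
  refine mul_nonneg (mul_nonneg (by linarith) hκ) ?_
  nlinarith

namespace StripSolution

variable {γ xB X : ℝ} {k : ℝ → ℝ} {S R Sx St Rx Rt : ℝ → ℝ → ℝ}

theorem continuousOn_slice_t {f : ℝ → ℝ → ℝ}
    (hf : ContinuousOn (fun p : ℝ × ℝ => f p.1 p.2) (Icc xB X ×ˢ Ici 0)) {x : ℝ}
    (hx : x ∈ Icc xB X) : ContinuousOn (fun t => f x t) (Ici 0) :=
  hf.comp (f := fun t : ℝ => (x, t)) (by fun_prop) fun t ht => ⟨hx, ht⟩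

theorem continuousOn_slice_x {f : ℝ → ℝ → ℝ}
    (hf : ContinuousOn (fun p : ℝ × ℝ => f p.1 p.2) (Icc xB X ×ˢ Ici 0)) {t : ℝ}
    (ht : 0 ≤ t) : ContinuousOn (fun x => f x t) (Icc xB X) :=
  hf.comp (f := fun x : ℝ => (x, t)) (by fun_prop) fun x hx => ⟨hx, ht⟩

/-- The order `0 < S < R` propagates from the initial and boundary data. -/
theorem pos_lt (h : StripSolution γ xB X k S R Sx St Rx Rt) (hγ1 : 1 < γ) (hγ3 : γ < 3)
    (hX : xB ≤ X)
    (h0 : ∀ x ∈ Icc xB X, 0 < S x 0 ∧ S x 0 < R x 0)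
    (hB : ∀ t ∈ Ici (0 : ℝ), 0 < S xB t ∧ S xB t < R xB t) :
    ∀ x ∈ Icc xB X, ∀ t ∈ Ici (0 : ℝ), 0 < S x t ∧ S x t < R x t := by
  intro x₁ hx₁ T hT
  have hsub : (Icc 0 T : Set ℝ) ⊆ Ici 0 := Icc_subset_Ici_self
  have hxB : xB ∈ Icc xB X := ⟨le_rfl, hX⟩
  have hD : ContinuousOn (fun p : ℝ × ℝ => R p.1 p.2 - S p.1 p.2) (Icc xB X ×ˢ Ici 0) :=
    h.R_cont.sub h.S_cont
  obtain ⟨σ₁, hσ₁, h₁⟩ := exists_pos_lt_of_continuousOn (continuousOn_slice_x h.S_cont le_rfl)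
    fun x hx => (h0 x hx).1
  obtain ⟨σ₂, hσ₂, h₂⟩ := exists_pos_lt_of_continuousOn
    ((continuousOn_slice_t h.S_cont hxB).mono (hsub : Icc 0 T ⊆ _)) fun t ht => (hB t ht.1).1
  obtain ⟨σ₃, hσ₃, h₃⟩ := exists_pos_lt_of_continuousOn
    (continuousOn_slice_x (f := fun x t => R x t - S x t) hD le_rfl)
    fun x hx => sub_pos.2 (h0 x hx).2
  obtain ⟨σ₄, hσ₄, h₄⟩ := exists_pos_lt_of_continuousOn
    ((continuousOn_slice_t (f := fun x t => R x t - S x t) hD hxB).mono (hsub : Icc 0 T ⊆ _))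
    fun t ht => sub_pos.2 (hB t ht.1).2
  -- The barriers start strictly below `S` and `R - S` on both the initial line and the left
  -- boundary.
  set σ := min σ₁ σ₂
  set τ := min σ₃ σ₄
  have hσ : 0 < σ := lt_min hσ₁ hσ₂
  have hτ : 0 < τ := lt_min hσ₃ hσ₄
  have hkc : ContinuousOn (fun p : ℝ × ℝ => k p.1) (Icc xB X ×ˢ Ici 0) :=
    h.k_cont.comp continuousOn_fst fun p hp => hp.1
  -- Subtracting the equations, `D = R - S` satisfies `D_t + λ₂ D_x = -D q`, where `q` is the
  -- function bounded here. A barrier with decay rate `N + 1` then falls strictly faster than `D`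
  -- can.
  obtain ⟨N, hN0, hN⟩ := exists_abs_le_strip (T := T)
    (f := fun x t => (γ - 1) / 4 * k x * (R x t + S x t) + (γ - 1) / 2 * Sx x t)
    (((continuousOn_const.mul hkc).mul (h.R_cont.add h.S_cont)).add
      (continuousOn_const.mul h.Sx_cont))
  have key := neg_of_transport (xB := xB) (X := X) (t₀ := 0) (T := T)
    (f := fun x t => σ * Real.exp (-t) - S x t)
    (g := fun x t => τ * Real.exp (-(N + 1) * t) - (R x t - S x t))
    (fx := fun x t => - Sx x t) (ft := fun x t => - (σ * Real.exp (-t)) - St x t)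
    (gx := fun x t => - (Rx x t - Sx x t))
    (gt := fun x t => -(N + 1) * (τ * Real.exp (-(N + 1) * t)) - (Rt x t - St x t))
    ((Continuous.continuousOn (by fun_prop)).sub
      (h.S_cont.mono (prod_mono_right hsub)))
    ((Continuous.continuousOn (by fun_prop)).sub (hD.mono (prod_mono_right hsub)))
    ?_ ?_ ?_ ?_ ?_ ?_ ?_ ?_ x₁ hx₁ T ⟨hT, le_rfl⟩
  · have e1 := mul_pos hσ (Real.exp_pos (-T))
    have e2 := mul_pos hτ (Real.exp_pos (-(N + 1) * T))
    constructor <;> linarith [key.1, key.2]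
  · intro x hx
    have := h₁ x hx
    have := h₃ x hx
    simp only [neg_zero, Real.exp_zero, mul_zero, mul_one]
    constructor
    · linarith [min_le_left σ₁ σ₂]
    · linarith [min_le_left σ₃ σ₄]
  · intro t ht
    have := h₂ t ht
    have := h₄ t ht
    have e1 : Real.exp (-t) ≤ 1 := Real.exp_le_one_iff.2 (by linarith [ht.1])
    have e2 : Real.exp (-(N + 1) * t) ≤ 1 := Real.exp_le_one_iff.2 (by nlinarith [ht.1])
    constructor
    · nlinarith [min_le_right σ₁ σ₂]
    · nlinarith [min_le_right σ₃ σ₄]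
  · intro x hx t ht
    exact ((h.S_x x ⟨hx.1.le, hx.2⟩ t ht.1.le).const_sub _)
  · intro x hx t ht
    exact (((h.R_x x ⟨hx.1.le, hx.2⟩ t ht.1.le).sub
      (h.S_x x ⟨hx.1.le, hx.2⟩ t ht.1.le)).const_sub _)
  · intro x hx t ht
    have e : HasDerivAt (fun s : ℝ => σ * Real.exp (-s)) (-(σ * Real.exp (-t))) t := by
      simpa using ((hasDerivAt_neg t).exp).const_mul σ
    exact e.hasDerivWithinAt.sub ((h.S_t x ⟨hx.1.le, hx.2⟩ t ht.1.le).mono hsub)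
  · intro x hx t ht
    have e : HasDerivAt (fun s : ℝ => τ * Real.exp (-(N + 1) * s))
        (-(N + 1) * (τ * Real.exp (-(N + 1) * t))) t := by
      have := ((hasDerivAt_const_mul (-(N + 1)) (x := t)).exp).const_mul τ
      rwa [mul_comm (Real.exp _), mul_left_comm] at this
    exact e.hasDerivWithinAt.sub (((h.R_t x ⟨hx.1.le, hx.2⟩ t ht.1.le).sub
      (h.S_t x ⟨hx.1.le, hx.2⟩ t ht.1.le)).mono hsub)
  · intro x hx t ht hf hg
    have hx' : x ∈ Icc xB X := ⟨hx.1.le, hx.2⟩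
    have e1 := mul_pos hσ (Real.exp_pos (-t))
    have e2 := mul_pos hτ (Real.exp_pos (-(N + 1) * t))
    have hS : 0 ≤ S x t := by linarith
    have hSR : S x t ≤ R x t := by linarith
    refine ⟨speed1 γ (S x t) (R x t), speed1_nonneg hγ1 hγ3 hS (hS.trans hSR), ?_⟩
    have := h.S_eq x hx' t ht.1.le
    have := source_nonneg hγ1 (h.k_nonneg x hx') hS hSR
    linarith
  · intro x hx t ht hg hf
    have hx' : x ∈ Icc xB X := ⟨hx.1.le, hx.2⟩
    have e1 := mul_pos hσ (Real.exp_pos (-t))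
    have e2 := mul_pos hτ (Real.exp_pos (-(N + 1) * t))
    have hS : 0 ≤ S x t := by linarith
    have hSR : S x t ≤ R x t := by linarith
    refine ⟨speed2 γ (S x t) (R x t), speed2_nonneg hγ1 hγ3 hS (hS.trans hSR), ?_⟩
    have a1 := h.S_eq x hx' t ht.1.le
    have a2 := h.R_eq x hx' t ht.1.le
    have a3 : R x t - S x t = τ * Real.exp (-(N + 1) * t) := by linarith
    have a4 := (abs_le.1 (hN x hx' t ⟨ht.1.le, ht.2⟩)).2
    rw [← a3] at e2 ⊢
    have a5 := mul_le_mul_of_nonneg_left a4 e2.le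
    unfold speed1 source at a1
    unfold speed2 source at a2
    unfold speed2
    nlinarith

end StripSolution
end DuctFlow

/-! ### Monotonicity in time through difference quotients -/

namespace DuctFlow

theorem exists_uniform_modulus_strip {xB X T ε : ℝ} {f : ℝ → ℝ → ℝ}
    (hf : ContinuousOn (fun p : ℝ × ℝ => f p.1 p.2) (Icc xB X ×ˢ Ici 0)) (hε : 0 < ε) :
    ∃ d : ℝ, 0 < d ∧ ∀ x ∈ Icc xB X, ∀ s ∈ Icc 0 T, ∀ t ∈ Icc 0 T, |s - t| < d →
      |f x s - f x t| < ε := by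
  have hu := (isCompact_Icc.prod isCompact_Icc).uniformContinuousOn_of_continuous
    (hf.mono (prod_mono_right (Icc_subset_Ici_self : Icc 0 T ⊆ Ici 0)))
  obtain ⟨d, hd, H⟩ := Metric.uniformContinuousOn_iff.1 hu ε hε
  refine ⟨d, hd, fun x hx s hs t ht hst => ?_⟩
  have := H (x, s) ⟨hx, hs⟩ (x, t) ⟨hx, ht⟩ (by
    rw [Prod.dist_eq, dist_self, Real.dist_eq]
    exact max_lt hd hst)
  rwa [Real.dist_eq] at this

/-- Transport equation for a difference quotient of `S`. -/
theorem transport_quotient_S {γ κ η S R Sx St S' R' Sx' St' : ℝ} (hη : η ≠ 0)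
    (e : St + speed1 γ S R * Sx = source γ κ S R)
    (e' : St' + speed1 γ S' R' * Sx' = source γ κ S' R') :
    (St' - St) / η + speed1 γ S R * ((Sx' - Sx) / η) =
      (R' - R) / η * ((γ - 1) / 8 * κ * (R' + R) - (3 - γ) / 4 * Sx')
        - (S' - S) / η * ((γ - 1) / 8 * κ * (S' + S) + (γ + 1) / 4 * Sx') := by
  unfold speed1 source at *
  field_simp
  linear_combination 32 * (e' - e)

/-- Transport equation for a difference quotient of `R`. -/
theorem transport_quotient_R {γ κ η S R Rx Rt S' R' Rx' Rt' : ℝ} (hη : η ≠ 0)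
    (e : Rt + speed2 γ S R * Rx = -source γ κ S R)
    (e' : Rt' + speed2 γ S' R' * Rx' = -source γ κ S' R') :
    (Rt' - Rt) / η + speed2 γ S R * ((Rx' - Rx) / η) =
      (S' - S) / η * ((γ - 1) / 8 * κ * (S' + S) - (3 - γ) / 4 * Rx')
        - (R' - R) / η * ((γ - 1) / 8 * κ * (R' + R) + (γ + 1) / 4 * Rx') := by
  unfold speed2 source at *
  field_simp
  linear_combination 32 * (e' - e)

/-- If `St ≥ 0`, the equation gives `λ₁ Sx ≤ g`, and `(3 - γ)/4 * (R² - S²) ≤ λ₁ R`. This yields the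
sign of the coefficient of the `R`-quotient in the `S`-quotient equation, exactly where `S` would be
increasing in time. -/
theorem slope_S_le {γ κ S R Sx St : ℝ} (hγ1 : 1 < γ) (hγ3 : γ < 3) (hκ : 0 ≤ κ) (hS : 0 < S)
    (hSR : S < R) (hSt : 0 ≤ St) (e : St + speed1 γ S R * Sx = source γ κ S R) :
    (3 - γ) / 4 * Sx ≤ (γ - 1) / 8 * κ * R := by
  have hR : 0 < R := hS.trans hSR
  have hpos : 0 < speed1 γ S R := by
    unfold speed1
    have := mul_pos (show 0 < (γ + 1) / 4 by linarith) hS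
    have := mul_pos (show 0 < (3 - γ) / 4 by linarith) hR
    linarith
  refine le_of_mul_le_mul_left ?_ hpos
  have h1 : speed1 γ S R * ((3 - γ) / 4 * Sx) = (3 - γ) / 4 * (source γ κ S R - St) := by
    linear_combination (3 - γ) / 4 * e
  rw [h1]
  have h2 : 0 ≤ (3 - γ) / 4 * St := mul_nonneg (by linarith) hSt
  have h3 : 0 ≤ (γ - 1) / 8 * κ * ((γ + 1) / 4 * (S * R) + (3 - γ) / 4 * S ^ 2) :=
    mul_nonneg (mul_nonneg (by linarith) hκ) (add_nonneg
      (mul_nonneg (by linarith) (mul_pos hS hR).le) (mul_nonneg (by linarith) (sq_nonneg S)))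
  unfold speed1 source
  nlinarith

/-- The counterpart for `R` is simpler: the source enters with a minus sign, so `Rt ≥ 0` forces `λ₂
Rx ≤ 0`. -/
theorem slope_R_nonpos {γ κ S R Rx Rt : ℝ} (hγ1 : 1 < γ) (hγ3 : γ < 3) (hκ : 0 ≤ κ) (hS : 0 < S)
    (hSR : S < R) (hRt : 0 ≤ Rt) (e : Rt + speed2 γ S R * Rx = -source γ κ S R) : Rx ≤ 0 := by
  have hR : 0 < R := hS.trans hSR
  have hpos : 0 < speed2 γ S R := by
    unfold speed2
    have := mul_pos (show 0 < (γ + 1) / 4 by linarith) hR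
    have := mul_pos (show 0 < (3 - γ) / 4 by linarith) hS
    linarith
  have := source_nonneg hγ1 hκ hS.le hSR.le
  by_contra! h
  nlinarith [mul_pos hpos h]

/-- A strictly decreasing quantity at a touching point: the abstract form of the estimate for both
difference quotients. -/
theorem quotient_rate_lt {u v φ A B L NA NB : ℝ} (hφ : 0 < φ) (hu : u = φ) (hv : v ≤ φ)
    (hA : 0 ≤ A) (hAN : A ≤ NA) (hBN : -B ≤ NB) (hL : NA + NB < L) : v * A - u * B < L * φ := by
  subst hu
  nlinarith [mul_le_mul_of_nonneg_right hv hA, mul_le_mul_of_nonneg_left hAN hφ.le,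
    mul_le_mul_of_nonneg_left hBN hφ.le, mul_lt_mul_of_pos_left hL hφ]

/-- The coupling coefficient needs an upper bound and the diagonal one only a lower bound. Together
they determine how fast the exponential barrier must grow. -/
theorem coefficient_bounds {γ κ P P' Q Q' D N : ℝ} (hγ1 : 1 < γ) (hγ3 : γ < 3) (hκ : 0 ≤ κ)
    (hκN : κ ≤ N) (hP' : |P'| ≤ N) (hP : |P| ≤ N) (hQ : 0 ≤ Q) (hQ' : 0 ≤ Q') (hD : |D| ≤ N) :
    (γ - 1) / 8 * κ * (P' + P) - (3 - γ) / 4 * D ≤ N ^ 2 + N ∧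
      -((γ - 1) / 8 * κ * (Q' + Q) + (γ + 1) / 4 * D) ≤ N := by
  have hN : 0 ≤ N := hκ.trans hκN
  obtain ⟨d1, d2⟩ := abs_le.1 hD
  have p1 := (abs_le.1 hP).2
  have p2 := (abs_le.1 hP').2
  constructor
  · have h1 : κ * (P' + P) ≤ N * (2 * N) :=
      (mul_le_mul_of_nonneg_left (by linarith) hκ).trans
        (mul_le_mul_of_nonneg_right hκN (by linarith))
    have h2 := mul_le_mul_of_nonneg_left h1 (show 0 ≤ (γ - 1) / 8 by linarith)
    have h3 := mul_le_mul_of_nonneg_left (show -D ≤ N by linarith) (show 0 ≤ (3 - γ) / 4 by linarith)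
    have h4 := mul_le_mul_of_nonneg_right (show (γ - 1) / 8 ≤ 1 / 2 by linarith)
      (show 0 ≤ N * (2 * N) by positivity)
    have h5 := mul_le_mul_of_nonneg_right (show (3 - γ) / 4 ≤ 1 by linarith) hN
    nlinarith
  · have h1 : 0 ≤ (γ - 1) / 8 * κ * (Q' + Q) :=
      mul_nonneg (mul_nonneg (by linarith) hκ) (by linarith)
    have h2 := mul_le_mul_of_nonneg_left (show -D ≤ N by linarith) (show 0 ≤ (γ + 1) / 4 by linarith)
    have h3 := mul_le_mul_of_nonneg_right (show (γ + 1) / 4 ≤ 1 by linarith) hN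
    linarith

namespace StripSolution

variable {γ xB X : ℝ} {k : ℝ → ℝ} {S R Sx St Rx Rt : ℝ → ℝ → ℝ}

theorem exists_eq_quotient {f ft : ℝ → ℝ → ℝ}
    (hf : ContinuousOn (fun p : ℝ × ℝ => f p.1 p.2) (Icc xB X ×ˢ Ici 0))
    (hft : ∀ x ∈ Icc xB X, ∀ t ∈ Ici (0 : ℝ),
      HasDerivWithinAt (fun s => f x s) (ft x t) (Ici 0) t)
    {x t η : ℝ} (hx : x ∈ Icc xB X) (ht : 0 ≤ t) (hη : 0 < η) :
    ∃ s ∈ Ioo t (t + η), ft x s = (f x (t + η) - f x t) / η := by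
  obtain ⟨s, hs, h⟩ := exists_hasDerivAt_eq_slope (fun s => f x s) (fun s => ft x s)
    (show t < t + η by linarith)
    ((continuousOn_slice_t hf hx).mono fun s hs => ht.trans hs.1)
    fun s hs => (hft x hx s (ht.trans hs.1.le)).hasDerivAt (Ici_mem_nhds (ht.trans_lt hs.1))
  exact ⟨s, hs, by simpa using h⟩

theorem hasDerivWithinAt_quotient_t {f ft : ℝ → ℝ → ℝ}
    (hft : ∀ x ∈ Icc xB X, ∀ t ∈ Ici (0 : ℝ),
      HasDerivWithinAt (fun s => f x s) (ft x t) (Ici 0) t)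
    {x t η : ℝ} (T : ℝ) (hx : x ∈ Icc xB X) (ht : 0 ≤ t) (hη : 0 < η) :
    HasDerivWithinAt (fun s => (f x (s + η) - f x s) / η) ((ft x (t + η) - ft x t) / η)
      (Icc 0 T) t := by
  have h1 : HasDerivWithinAt (fun s => f x (s + η)) (ft x (t + η) * 1) (Icc 0 T) t :=
    HasDerivWithinAt.comp (h := fun s => s + η) (h₂ := fun s => f x s) (s' := Ici 0) t
      (hft x hx (t + η) (add_nonneg ht hη.le)) ((hasDerivWithinAt_id t _).add_const η)
      fun s hs => add_nonneg hs.1 hη.le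
  rw [mul_one] at h1
  exact (h1.sub ((hft x hx t ht).mono Icc_subset_Ici_self)).div_const η

theorem continuousOn_quotient {f : ℝ → ℝ → ℝ} {η : ℝ} (T : ℝ) (hη : 0 < η)
    (hf : ContinuousOn (fun p : ℝ × ℝ => f p.1 p.2) (Icc xB X ×ˢ Ici 0)) :
    ContinuousOn (fun p : ℝ × ℝ => (f p.1 (p.2 + η) - f p.1 p.2) / η) (Icc xB X ×ˢ Icc 0 T) := by
  refine ContinuousOn.div_const (ContinuousOn.sub ?_ ?_) _
  · exact hf.comp (f := fun p : ℝ × ℝ => (p.1, p.2 + η)) (by fun_prop)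
      fun p hp => ⟨hp.1, add_nonneg hp.2.1 hη.le⟩
  · exact hf.mono (prod_mono_right Icc_subset_Ici_self)

/-- Monotonicity in time propagates from the initial and boundary data. -/
theorem deriv_t_nonpos (h : StripSolution γ xB X k S R Sx St Rx Rt) (hγ1 : 1 < γ) (hγ3 : γ < 3)
    (hpos : ∀ x ∈ Icc xB X, ∀ t ∈ Ici (0 : ℝ), 0 < S x t ∧ S x t < R x t)
    (h0 : ∀ x ∈ Icc xB X, St x 0 ≤ 0 ∧ Rt x 0 ≤ 0)
    (hB : ∀ t ∈ Ici (0 : ℝ), St xB t ≤ 0 ∧ Rt xB t ≤ 0) :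
    ∀ x ∈ Icc xB X, ∀ t ∈ Ici (0 : ℝ), St x t ≤ 0 ∧ Rt x t ≤ 0 := by
  intro x₁ hx₁ T (hT : 0 ≤ T)
  have hxB : xB ∈ Icc xB X := ⟨le_rfl, hx₁.1.trans hx₁.2⟩
  have hkc : ContinuousOn (fun p : ℝ × ℝ => k p.1) (Icc xB X ×ˢ Ici 0) :=
    h.k_cont.comp continuousOn_fst fun p hp => hp.1
  -- Bounds are taken up to `T + 1` because the quotients look ahead by `η < 1`.
  obtain ⟨N₁, hN₁, hk⟩ := exists_abs_le_strip (T := T + 1) (f := fun x _ => k x) hkc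
  obtain ⟨N₂, hN₂, hS⟩ := exists_abs_le_strip (T := T + 1) h.S_cont
  obtain ⟨N₃, hN₃, hR⟩ := exists_abs_le_strip (T := T + 1) h.R_cont
  obtain ⟨N₄, hN₄, hSx⟩ := exists_abs_le_strip (T := T + 1) h.Sx_cont
  obtain ⟨N₅, hN₅, hRx⟩ := exists_abs_le_strip (T := T + 1) h.Rx_cont
  set N := N₁ + N₂ + N₃ + N₄ + N₅
  -- `N ^ 2 + N` bounds the coupling, `N` the diagonal term, and `1` makes the inequality strict.
  -- `L` does not depend on `ε`, so `ε` can tend to `0` at the end.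
  set L := N ^ 2 + N + N + 1
  have main : ∀ ε : ℝ, 0 < ε → St x₁ T ≤ ε * (Real.exp (L * T) + 1) ∧
      Rt x₁ T ≤ ε * (Real.exp (L * T) + 1) := by
    intro ε hε
    obtain ⟨d₁, hd₁, m₁⟩ := exists_uniform_modulus_strip (T := T + 1) h.St_cont (half_pos hε)
    obtain ⟨d₂, hd₂, m₂⟩ := exists_uniform_modulus_strip (T := T + 1) h.Rt_cont (half_pos hε)
    obtain ⟨η, hη, hηlt⟩ := exists_between (lt_min one_pos (lt_min hd₁ hd₂))
    have hη1 : η < 1 := hηlt.trans_le (min_le_left _ _)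
    have hηd₁ : η < d₁ := hηlt.trans_le ((min_le_right _ _).trans (min_le_left _ _))
    have hηd₂ : η < d₂ := hηlt.trans_le ((min_le_right _ _).trans (min_le_right _ _))
    -- Closeness at `t` converts between signs of derivatives and of quotients. Closeness at `t + η`
    -- is needed because the quotient equations contain the space derivative at the later time.
    have near : ∀ {f ft : ℝ → ℝ → ℝ} {d : ℝ},
        ContinuousOn (fun p : ℝ × ℝ => f p.1 p.2) (Icc xB X ×ˢ Ici 0) →
        (∀ x ∈ Icc xB X, ∀ t ∈ Ici (0 : ℝ),
          HasDerivWithinAt (fun s => f x s) (ft x t) (Ici 0) t) →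
        (∀ x ∈ Icc xB X, ∀ s ∈ Icc 0 (T + 1), ∀ t ∈ Icc 0 (T + 1), |s - t| < d →
          |ft x s - ft x t| < ε / 2) → η < d →
        ∀ x ∈ Icc xB X, ∀ t ∈ Icc 0 T,
          |(f x (t + η) - f x t) / η - ft x t| < ε / 2 ∧
          |(f x (t + η) - f x t) / η - ft x (t + η)| < ε / 2 := by
      intro f ft d hf hft hm hd x hx t ht
      obtain ⟨s, hs, e⟩ := exists_eq_quotient hf hft hx ht.1 hη
      rw [← e]
      have hs' : s ∈ Icc 0 (T + 1) :=
        ⟨ht.1.trans hs.1.le, by linarith [hs.2, ht.2]⟩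
      constructor
      · refine hm x hx s hs' t ⟨ht.1, by linarith [ht.2]⟩ ?_
        rw [abs_lt]; constructor <;> linarith [hs.1, hs.2]
      · refine hm x hx s hs' (t + η) ⟨by linarith [ht.1], by linarith [ht.2]⟩ ?_
        rw [abs_lt]; constructor <;> linarith [hs.1, hs.2]
    have nearS := near h.S_cont h.S_t m₁ hηd₁
    have nearR := near h.R_cont h.R_t m₂ hηd₂
    have hexp : ∀ t ∈ Icc 0 T, ε ≤ ε * Real.exp (L * t) := by
      intro t ht
      have hL : 0 ≤ L := by positivity
      have := Real.one_le_exp (mul_nonneg hL ht.1)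
      nlinarith
    have hE : ∀ t : ℝ, HasDerivAt (fun s : ℝ => ε * Real.exp (L * s))
        (L * (ε * Real.exp (L * t))) t := by
      intro t
      have := ((hasDerivAt_const_mul L (x := t)).exp).const_mul ε
      rwa [mul_comm (Real.exp _), mul_left_comm] at this
    have key := neg_of_transport (xB := xB) (X := X) (t₀ := 0) (T := T)
      (f := fun x t => (S x (t + η) - S x t) / η - ε * Real.exp (L * t))
      (g := fun x t => (R x (t + η) - R x t) / η - ε * Real.exp (L * t))
      (fx := fun x t => (Sx x (t + η) - Sx x t) / η)
      (ft := fun x t => (St x (t + η) - St x t) / η - L * (ε * Real.exp (L * t)))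
      (gx := fun x t => (Rx x (t + η) - Rx x t) / η)
      (gt := fun x t => (Rt x (t + η) - Rt x t) / η - L * (ε * Real.exp (L * t)))
      ((continuousOn_quotient T hη h.S_cont).sub (Continuous.continuousOn (by fun_prop)))
      ((continuousOn_quotient T hη h.R_cont).sub (Continuous.continuousOn (by fun_prop)))
      ?_ ?_ ?_ ?_ ?_ ?_ ?_ ?_ x₁ hx₁ T ⟨hT, le_rfl⟩
    · have a1 := (abs_lt.1 (nearS x₁ hx₁ T ⟨hT, le_rfl⟩).1).1
      have a2 := (abs_lt.1 (nearR x₁ hx₁ T ⟨hT, le_rfl⟩).1).1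
      constructor <;> linarith [key.1, key.2]
    · intro x hx
      have a1 := (abs_lt.1 (nearS x hx 0 ⟨le_rfl, hT⟩).1).2
      have a2 := (abs_lt.1 (nearR x hx 0 ⟨le_rfl, hT⟩).1).2
      have a3 := hexp 0 ⟨le_rfl, hT⟩
      constructor <;> linarith [(h0 x hx).1, (h0 x hx).2]
    · intro t ht
      have a1 := (abs_lt.1 (nearS xB hxB t ht).1).2
      have a2 := (abs_lt.1 (nearR xB hxB t ht).1).2
      have a3 := hexp t ht
      constructor <;> linarith [(hB t ht.1).1, (hB t ht.1).2]
    · intro x hx t ht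
      have hx' : x ∈ Icc xB X := ⟨hx.1.le, hx.2⟩
      exact (((h.S_x x hx' (t + η) (add_nonneg ht.1.le hη.le)).sub
        (h.S_x x hx' t ht.1.le)).div_const η).sub_const _
    · intro x hx t ht
      have hx' : x ∈ Icc xB X := ⟨hx.1.le, hx.2⟩
      exact (((h.R_x x hx' (t + η) (add_nonneg ht.1.le hη.le)).sub
        (h.R_x x hx' t ht.1.le)).div_const η).sub_const _
    · intro x hx t ht
      exact (hasDerivWithinAt_quotient_t h.S_t T ⟨hx.1.le, hx.2⟩ ht.1.le hη).sub
        (hE t).hasDerivWithinAt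
    · intro x hx t ht
      exact (hasDerivWithinAt_quotient_t h.R_t T ⟨hx.1.le, hx.2⟩ ht.1.le hη).sub
        (hE t).hasDerivWithinAt
    · intro x hx t ht hf hg
      have hx' : x ∈ Icc xB X := ⟨hx.1.le, hx.2⟩
      have ht' : t ∈ Icc 0 (T + 1) := ⟨ht.1.le, by linarith [ht.2]⟩
      have hs' : t + η ∈ Icc 0 (T + 1) := ⟨by linarith [ht.1], by linarith [ht.2]⟩
      obtain ⟨p1, p2⟩ := hpos x hx' t ht.1.le
      obtain ⟨q1, q2⟩ := hpos x hx' (t + η) hs'.1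
      have a1 := hexp t ⟨ht.1.le, ht.2⟩
      -- At a touching point the quotient is at least `ε`, so `St x (t + η) > ε / 2 > 0`, and
      -- `slope_S_le` makes the coupling coefficient nonnegative.
      have a2 := (abs_lt.1 (nearS x hx' t ⟨ht.1.le, ht.2⟩).2).2
      have a3 := slope_S_le hγ1 hγ3 (h.k_nonneg x hx') q1 q2 (by linarith)
        (h.S_eq x hx' (t + η) hs'.1)
      have a4 : 0 ≤ (γ - 1) / 8 * k x * R x t :=
        mul_nonneg (mul_nonneg (by linarith) (h.k_nonneg x hx')) (p1.trans p2).le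
      obtain ⟨b1, b2⟩ := coefficient_bounds (N := N) hγ1 hγ3 (h.k_nonneg x hx')
        ((le_abs_self _).trans ((hk x hx' t ht').trans (by linarith)))
        ((hR x hx' _ hs').trans (by linarith)) ((hR x hx' t ht').trans (by linarith))
        p1.le q1.le ((hSx x hx' _ hs').trans (by linarith))
      refine ⟨speed1 γ (S x t) (R x t), speed1_nonneg hγ1 hγ3 p1.le (p1.trans p2).le, ?_⟩
      have e := transport_quotient_S hη.ne' (h.S_eq x hx' t ht.1.le)
        (h.S_eq x hx' (t + η) hs'.1)
      have := quotient_rate_lt (L := L) (hε.trans_le a1) (sub_eq_zero.1 hf) (sub_nonpos.1 hg)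
        (by linarith) b1 b2 (by linarith)
      linarith
    · intro x hx t ht hg hf
      have hx' : x ∈ Icc xB X := ⟨hx.1.le, hx.2⟩
      have ht' : t ∈ Icc 0 (T + 1) := ⟨ht.1.le, by linarith [ht.2]⟩
      have hs' : t + η ∈ Icc 0 (T + 1) := ⟨by linarith [ht.1], by linarith [ht.2]⟩
      obtain ⟨p1, p2⟩ := hpos x hx' t ht.1.le
      obtain ⟨q1, q2⟩ := hpos x hx' (t + η) hs'.1
      have a1 := hexp t ⟨ht.1.le, ht.2⟩
      have a2 := (abs_lt.1 (nearR x hx' t ⟨ht.1.le, ht.2⟩).2).2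
      have a3 := mul_nonpos_of_nonneg_of_nonpos (show 0 ≤ (3 - γ) / 4 by linarith)
        (slope_R_nonpos hγ1 hγ3 (h.k_nonneg x hx') q1 q2 (by linarith)
        (h.R_eq x hx' (t + η) hs'.1))
      have a4 : 0 ≤ (γ - 1) / 8 * k x * (S x (t + η) + S x t) :=
        mul_nonneg (mul_nonneg (by linarith) (h.k_nonneg x hx')) (by linarith)
      obtain ⟨b1, b2⟩ := coefficient_bounds (N := N) hγ1 hγ3 (h.k_nonneg x hx')
        ((le_abs_self _).trans ((hk x hx' t ht').trans (by linarith)))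
        ((hS x hx' _ hs').trans (by linarith)) ((hS x hx' t ht').trans (by linarith))
        (p1.trans p2).le (q1.trans q2).le ((hRx x hx' _ hs').trans (by linarith))
      refine ⟨speed2 γ (S x t) (R x t), speed2_nonneg hγ1 hγ3 p1.le (p1.trans p2).le, ?_⟩
      have e := transport_quotient_R hη.ne' (h.R_eq x hx' t ht.1.le)
        (h.R_eq x hx' (t + η) hs'.1)
      have := quotient_rate_lt (L := L) (hε.trans_le a1) (sub_eq_zero.1 hg) (sub_nonpos.1 hf)
        (by linarith) b1 b2 (by linarith)
      linarith
  have lim : ∀ y C : ℝ, 0 < C → (∀ ε : ℝ, 0 < ε → y ≤ ε * C) → y ≤ 0 := by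
    intro y C hC hy
    refine le_of_forall_pos_le_add fun ε hε => ?_
    have := hy (ε / C) (div_pos hε hC)
    rwa [div_mul_cancel₀ _ hC.ne', ← zero_add ε] at this
  have hC : 0 < Real.exp (L * T) + 1 := by positivity
  exact ⟨lim _ _ hC fun ε hε => (main ε hε).1, lim _ _ hC fun ε hε => (main ε hε).2⟩

/-! ### Decay: barrier in the strip and Riccati inequality -/

/-- Decay like `1 / t` propagates from the boundary into the strip. -/
theorem le_div_of_boundary (h : StripSolution γ xB X k S R Sx St Rx Rt) (hγ1 : 1 < γ)
    (hγ3 : γ < 3) (hpos : ∀ x ∈ Icc xB X, ∀ t ∈ Ici (0 : ℝ), 0 < S x t ∧ S x t < R x t)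
    {Q : ℝ} (hQ : 0 ≤ Q) (hB : ∀ t : ℝ, 0 < t → R xB t ≤ Q / t) :
    ∀ x ∈ Icc xB X, ∀ t : ℝ, 0 < t → R x t ≤ (8 / (γ + 1) * (x - xB) + Q + 1) / t := by
  intro x₁ hx₁ T hT
  obtain ⟨N, hN0, hN⟩ := exists_abs_le_strip (T := T) h.R_cont
  -- Chosen so that `λ₂ A ≥ (γ + 1)/4 * R * A = 2 R`: where the barrier equals `R`, its transport
  -- gain `2 R / t` beats its loss `R / t` in time.
  set A := 8 / (γ + 1) with hA
  have hA0 : 0 < A := div_pos (by norm_num) (by linarith)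
  -- The comparison starts at a positive time so small that the barrier, at least `1 / τ ≥ N + 1`,
  -- exceeds `R`.
  set τ := min T (1 / (N + 1))
  have hτ : 0 < τ := lt_min hT (by positivity)
  have hτT : τ ≤ T := min_le_left _ _
  have hsub : Icc τ T ⊆ Ici (0 : ℝ) := fun t ht => hτ.le.trans ht.1
  have hcont : ContinuousOn (fun p : ℝ × ℝ => R p.1 p.2 - (A * (p.1 - xB) + Q + 1) / p.2)
      (Icc xB X ×ˢ Icc τ T) :=
    (h.R_cont.mono (prod_mono_right hsub)).sub
      (ContinuousOn.div (Continuous.continuousOn (by fun_prop)) continuousOn_snd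
        fun p hp => (hτ.trans_le hp.2.1).ne')
  have hinit : ∀ x ∈ Icc xB X, R x τ - (A * (x - xB) + Q + 1) / τ < 0 := by
    intro x hx
    rw [sub_neg, lt_div_iff₀ hτ]
    have h1 := (abs_le.1 (hN x hx τ ⟨hτ.le, hτT⟩)).2
    have h2 : τ * (N + 1) ≤ 1 := by
      have : τ ≤ 1 / (N + 1) := min_le_right _ _
      rwa [le_div_iff₀ (by linarith)] at this
    have h3 := mul_nonneg hA0.le (sub_nonneg.2 hx.1)
    nlinarith
  have hbdry : ∀ t ∈ Icc τ T, R xB t - (A * (xB - xB) + Q + 1) / t < 0 := by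
    intro t ht
    have ht0 := hτ.trans_le ht.1
    have := hB t ht0
    have h2 : Q / t < (A * (xB - xB) + Q + 1) / t := by
      apply div_lt_div_of_pos_right _ ht0
      linarith
    linarith
  have hx_d : ∀ x ∈ Ioc xB X, ∀ t ∈ Ioc τ T,
      HasDerivWithinAt (fun y => R y t - (A * (y - xB) + Q + 1) / t) (Rx x t - A / t)
        (Icc xB X) x := by
    intro x hx t ht
    have e : HasDerivAt (fun y : ℝ => (A * (y - xB) + Q + 1) / t) (A / t) x := by
      simpa using (((((hasDerivAt_id x).sub_const xB).const_mul A).add_const Q).add_const 1).div_const t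
    exact (h.R_x x ⟨hx.1.le, hx.2⟩ t (hτ.trans ht.1).le).sub e.hasDerivWithinAt
  have ht_d : ∀ x ∈ Ioc xB X, ∀ t ∈ Ioc τ T,
      HasDerivWithinAt (fun s => R x s - (A * (x - xB) + Q + 1) / s)
        (Rt x t + (A * (x - xB) + Q + 1) / t / t) (Icc τ T) t := by
    intro x hx t ht
    have ht0 := hτ.trans ht.1
    have e : HasDerivAt (fun s : ℝ => (A * (x - xB) + Q + 1) / s)
        (-((A * (x - xB) + Q + 1) / t / t)) t := by
      have := (hasDerivAt_inv ht0.ne').const_mul (A * (x - xB) + Q + 1)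
      simp only [← div_eq_mul_inv] at this
      exact this.congr_deriv (by ring)
    have := ((h.R_t x ⟨hx.1.le, hx.2⟩ t ht0.le).mono hsub).sub e.hasDerivWithinAt
    rwa [sub_neg_eq_add] at this
  have hdec : ∀ x ∈ Ioc xB X, ∀ t ∈ Ioc τ T, R x t - (A * (x - xB) + Q + 1) / t = 0 →
      R x t - (A * (x - xB) + Q + 1) / t ≤ 0 →
      ∃ c : ℝ, 0 ≤ c ∧ Rt x t + (A * (x - xB) + Q + 1) / t / t + c * (Rx x t - A / t) < 0 := by
    intro x hx t ht hz _
    have hx' : x ∈ Icc xB X := ⟨hx.1.le, hx.2⟩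
    have ht0 := hτ.trans ht.1
    obtain ⟨p1, p2⟩ := hpos x hx' t ht0.le
    refine ⟨speed2 γ (S x t) (R x t), speed2_nonneg hγ1 hγ3 p1.le (p1.trans p2).le, ?_⟩
    have e := h.R_eq x hx' t ht0.le
    have e2 := source_nonneg hγ1 (h.k_nonneg x hx') p1.le p2.le
    rw [← sub_eq_zero.1 hz]
    have e3 : 2 * (R x t / t) ≤ speed2 γ (S x t) (R x t) * (A / t) := by
      rw [mul_div_assoc', mul_div_assoc']
      apply div_le_div_of_nonneg_right _ ht0.le
      have : (γ + 1) / 4 * R x t * A = 2 * R x t := by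
        rw [hA]
        have : γ + 1 ≠ 0 := by linarith
        field_simp; ring
      rw [← this]
      apply mul_le_mul_of_nonneg_right _ hA0.le
      unfold speed2
      linarith [mul_nonneg (show 0 ≤ (3 - γ) / 4 by linarith) p1.le]
    have e4 : 0 < R x t / t := div_pos (p1.trans p2) ht0
    linarith
  -- A scalar comparison, run through the two-function principle with both functions equal.
  have key := neg_of_transport (xB := xB) (X := X) (t₀ := τ) (T := T) hcont hcont
    (fun x hx => ⟨hinit x hx, hinit x hx⟩) (fun t ht => ⟨hbdry t ht, hbdry t ht⟩)
    hx_d hx_d ht_d ht_d hdec hdec x₁ hx₁ T ⟨hτT, le_rfl⟩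
  exact (sub_neg.1 key.1).le

end StripSolution

/-- A positive solution of the Riccati inequality `y' ≤ -κ y²` decays like `1 / (κ t)`. -/
theorem le_div_of_riccati {y y' : ℝ → ℝ} {κ : ℝ} (hκ : 0 < κ) (hpos : ∀ t ∈ Ici (0 : ℝ), 0 < y t)
    (hy : ∀ t ∈ Ici (0 : ℝ), HasDerivWithinAt y (y' t) (Ici 0) t)
    (hle : ∀ t ∈ Ici (0 : ℝ), y' t ≤ -κ * y t ^ 2) : ∀ t : ℝ, 0 < t → y t ≤ 1 / κ / t := by
  intro t ht
  have hd : ∀ s ∈ Ici (0 : ℝ), HasDerivWithinAt (fun s => (y s)⁻¹ - κ * s)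
      (-y' s / y s ^ 2 - κ) (Ici 0) s := fun s hs =>
    ((hy s hs).inv (hpos s hs).ne').sub (hasDerivAt_const_mul κ).hasDerivWithinAt
  -- The inequality linearises for the reciprocal: `(1/y)' = -y'/y² ≥ κ`.
  have hm : MonotoneOn (fun s => (y s)⁻¹ - κ * s) (Ici 0) := by
    refine monotoneOn_of_hasDerivWithinAt_nonneg (convex_Ici 0)
      (fun s hs => (hd s hs).continuousWithinAt)
      (fun s hs => (hd s (interior_subset hs)).mono interior_subset) fun s hs => ?_
    have hs' := interior_subset hs
    rw [sub_nonneg, le_div_iff₀ (pow_pos (hpos s hs') 2)]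
    linarith [hle s hs']
  have h1 := hm (mem_Ici.2 le_rfl) (mem_Ici.2 ht.le) ht.le
  have h2 := inv_pos.2 (hpos 0 (mem_Ici.2 le_rfl))
  simp only [mul_zero, sub_zero] at h1
  have h3 : κ * t ≤ (y t)⁻¹ := by linarith
  rw [div_div, one_div]
  exact (le_inv_comm₀ (mul_pos hκ ht) (hpos t ht.le)).1 h3

end DuctFlow

/-! ### From the initial-boundary value problem to strips -/

namespace DuctFlow

namespace IsDuctInterval

variable {xB : ℝ} {I : Set ℝ}

theorem left_mem (hI : IsDuctInterval xB I) : xB ∈ I := by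
  rcases hI with ⟨xC, h, rfl⟩ | rfl
  · exact ⟨le_rfl, h.le⟩
  · exact le_refl xB

theorem convex (hI : IsDuctInterval xB I) : Convex ℝ I := by
  rcases hI with ⟨xC, h, rfl⟩ | rfl
  · exact convex_Icc _ _
  · exact convex_Ici _

theorem le_of_mem (hI : IsDuctInterval xB I) {x : ℝ} (hx : x ∈ I) : xB ≤ x := by
  rcases hI with ⟨xC, h, rfl⟩ | rfl
  · exact hx.1
  · exact hx

theorem Icc_subset (hI : IsDuctInterval xB I) {x : ℝ} (hx : x ∈ I) : Icc xB x ⊆ I :=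
  hI.convex.ordConnected.out hI.left_mem hx

theorem subset_closure_interior (hI : IsDuctInterval xB I) : I ⊆ closure (interior I) := by
  rcases hI with ⟨xC, h, rfl⟩ | rfl
  · rw [interior_Icc, closure_Ioo h.ne]
  · rw [interior_Ici, closure_Ioi]

theorem uniqueDiffOn (hI : IsDuctInterval xB I) : UniqueDiffOn ℝ I := by
  rcases hI with ⟨xC, h, rfl⟩ | rfl
  · exact uniqueDiffOn_Icc h
  · exact uniqueDiffOn_Ici _

end IsDuctInterval

theorem hasDerivWithinAt_slice_x {I : Set ℝ} {F : ℝ → ℝ → ℝ}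
    (hF : ContDiffOn ℝ 1 (fun p : ℝ × ℝ => F p.1 p.2) (I ×ˢ Ici (0 : ℝ))) {x t : ℝ}
    (hx : x ∈ I) (ht : t ∈ Ici (0 : ℝ)) :
    HasDerivWithinAt (fun y => F y t)
      (fderivWithin ℝ (fun p : ℝ × ℝ => F p.1 p.2) (I ×ˢ Ici (0 : ℝ)) (x, t) (1, 0)) I x :=
  HasFDerivWithinAt.comp_hasDerivWithinAt (f := fun y : ℝ => (y, t)) x
    ((hF.differentiableOn one_ne_zero) (x, t) ⟨hx, ht⟩).hasFDerivWithinAt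
    ((hasDerivWithinAt_id x I).prodMk (hasDerivWithinAt_const x I t)) fun _ hy => ⟨hy, ht⟩

theorem hasDerivWithinAt_slice_t {I : Set ℝ} {F : ℝ → ℝ → ℝ}
    (hF : ContDiffOn ℝ 1 (fun p : ℝ × ℝ => F p.1 p.2) (I ×ˢ Ici (0 : ℝ))) {x t : ℝ}
    (hx : x ∈ I) (ht : t ∈ Ici (0 : ℝ)) :
    HasDerivWithinAt (fun s => F x s)
      (fderivWithin ℝ (fun p : ℝ × ℝ => F p.1 p.2) (I ×ˢ Ici (0 : ℝ)) (x, t) (0, 1)) (Ici 0) t :=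
  HasFDerivWithinAt.comp_hasDerivWithinAt (f := fun s : ℝ => (x, s)) t
    ((hF.differentiableOn one_ne_zero) (x, t) ⟨hx, ht⟩).hasFDerivWithinAt
    ((hasDerivWithinAt_const t (Ici 0) x).prodMk (hasDerivWithinAt_id t (Ici 0)))
    fun _ hy => ⟨hx, hy⟩

/-- A `C¹` solution satisfies the equations up to the boundary. -/
theorem IsGlobalC1Solution.exists_stripSolution {γ xB : ℝ} {I : Set ℝ}
    {k S0 R0 SB RB : ℝ → ℝ} {S R : ℝ → ℝ → ℝ} (hI : IsDuctInterval xB I)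
    (hk : ContinuousOn k I) (hk0 : ∀ x ∈ I, 0 ≤ k x)
    (h : IsGlobalC1Solution γ xB I k S0 R0 SB RB S R) :
    ∃ Sx St Rx Rt : ℝ → ℝ → ℝ,
      (∀ x ∈ I, HasDerivWithinAt S0 (Sx x 0) I x ∧ HasDerivWithinAt R0 (Rx x 0) I x) ∧
      (∀ t ∈ Ici (0 : ℝ), HasDerivWithinAt SB (St xB t) (Ici 0) t ∧
        HasDerivWithinAt RB (Rt xB t) (Ici 0) t) ∧
      ∀ X ∈ I, StripSolution γ xB X k S R Sx St Rx Rt := by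
  have hU : UniqueDiffOn ℝ (I ×ˢ Ici (0 : ℝ)) := hI.uniqueDiffOn.prod (uniqueDiffOn_Ici 0)
  set DS := fderivWithin ℝ (fun p : ℝ × ℝ => S p.1 p.2) (I ×ˢ Ici (0 : ℝ)) with hDS
  set DR := fderivWithin ℝ (fun p : ℝ × ℝ => R p.1 p.2) (I ×ˢ Ici (0 : ℝ)) with hDR
  have cS : ContinuousOn DS (I ×ˢ Ici (0 : ℝ)) := h.S_C1.continuousOn_fderivWithin hU le_rfl
  have cR : ContinuousOn DR (I ×ˢ Ici (0 : ℝ)) := h.R_C1.continuousOn_fderivWithin hU le_rfl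
  have cSv : ∀ v : ℝ × ℝ, ContinuousOn (fun p : ℝ × ℝ => DS (p.1, p.2) v) (I ×ˢ Ici (0 : ℝ)) :=
    fun v => cS.clm_apply continuousOn_const
  have cRv : ∀ v : ℝ × ℝ, ContinuousOn (fun p : ℝ × ℝ => DR (p.1, p.2) v) (I ×ˢ Ici (0 : ℝ)) :=
    fun v => cR.clm_apply continuousOn_const
  have kS := h.S_C1.continuousOn
  have kR := h.R_C1.continuousOn
  have kk : ContinuousOn (fun p : ℝ × ℝ => k p.1) (I ×ˢ Ici (0 : ℝ)) :=
    hk.comp continuousOn_fst fun p hp => hp.1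
  have hg : ContinuousOn (fun p : ℝ × ℝ => source γ (k p.1) (S p.1 p.2) (R p.1 p.2))
      (I ×ˢ Ici (0 : ℝ)) :=
    (continuousOn_const.mul kk).mul ((kR.pow 2).sub (kS.pow 2))
  have hsub : interior I ×ˢ Ioi (0 : ℝ) ⊆ I ×ˢ Ici (0 : ℝ) :=
    prod_mono interior_subset Ioi_subset_Ici_self
  -- The equations are given only in the open region. Density and continuity of the derivatives up
  -- to the boundary extend them to the edges, where they turn slope conditions into signs of time
  -- derivatives.
  have hcl : I ×ˢ Ici (0 : ℝ) ⊆ closure (interior I ×ˢ Ioi (0 : ℝ)) := by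
    rw [closure_prod_eq, closure_Ioi]
    exact prod_mono hI.subset_closure_interior subset_rfl
  have eS : EqOn (fun p : ℝ × ℝ => DS (p.1, p.2) (0, 1)
        + speed1 γ (S p.1 p.2) (R p.1 p.2) * DS (p.1, p.2) (1, 0))
      (fun p => source γ (k p.1) (S p.1 p.2) (R p.1 p.2)) (I ×ˢ Ici (0 : ℝ)) := by
    refine EqOn.of_subset_closure (s := interior I ×ˢ Ioi (0 : ℝ)) ?_ ?_ hg hsub hcl
    · rintro ⟨x, t⟩ ⟨hx, ht⟩
      have hx' := interior_subset hx
      have ht' : t ∈ Ici (0 : ℝ) := Ioi_subset_Ici_self ht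
      have e1 := ((hasDerivWithinAt_slice_x h.S_C1 hx' ht').hasDerivAt
        (mem_interior_iff_mem_nhds.1 hx)).deriv
      have e2 := ((hasDerivWithinAt_slice_t h.S_C1 hx' ht').hasDerivAt (Ici_mem_nhds ht)).deriv
      have := h.S_eq x hx t ht
      rw [e1, e2] at this
      exact this
    · exact (cSv _).add (((continuousOn_const.mul kS).add (continuousOn_const.mul kR)).mul (cSv _))
  have eR : EqOn (fun p : ℝ × ℝ => DR (p.1, p.2) (0, 1)
        + speed2 γ (S p.1 p.2) (R p.1 p.2) * DR (p.1, p.2) (1, 0))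
      (fun p => -source γ (k p.1) (S p.1 p.2) (R p.1 p.2)) (I ×ˢ Ici (0 : ℝ)) := by
    refine EqOn.of_subset_closure (s := interior I ×ˢ Ioi (0 : ℝ)) ?_ ?_ hg.neg hsub hcl
    · rintro ⟨x, t⟩ ⟨hx, ht⟩
      have hx' := interior_subset hx
      have ht' : t ∈ Ici (0 : ℝ) := Ioi_subset_Ici_self ht
      have e1 := ((hasDerivWithinAt_slice_x h.R_C1 hx' ht').hasDerivAt
        (mem_interior_iff_mem_nhds.1 hx)).deriv
      have e2 := ((hasDerivWithinAt_slice_t h.R_C1 hx' ht').hasDerivAt (Ici_mem_nhds ht)).deriv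
      have := h.R_eq x hx t ht
      rw [e1, e2] at this
      exact this
    · exact (cRv _).add (((continuousOn_const.mul kS).add (continuousOn_const.mul kR)).mul (cRv _))
  have z : (0 : ℝ) ∈ Ici (0 : ℝ) := mem_Ici.2 le_rfl
  refine ⟨fun x t => DS (x, t) (1, 0), fun x t => DS (x, t) (0, 1), fun x t => DR (x, t) (1, 0),
    fun x t => DR (x, t) (0, 1), fun x hx => ⟨?_, ?_⟩, fun t ht => ⟨?_, ?_⟩, fun X hX => ?_⟩
  · exact (hasDerivWithinAt_slice_x h.S_C1 hx z).congr_of_mem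
      (fun y hy => (h.initial y hy).1.symm) hx
  · exact (hasDerivWithinAt_slice_x h.R_C1 hx z).congr_of_mem
      (fun y hy => (h.initial y hy).2.symm) hx
  · exact (hasDerivWithinAt_slice_t h.S_C1 hI.left_mem ht).congr_of_mem
      (fun s hs => (h.boundary s hs).1.symm) ht
  · exact (hasDerivWithinAt_slice_t h.R_C1 hI.left_mem ht).congr_of_mem
      (fun s hs => (h.boundary s hs).2.symm) ht
  · have hXI := hI.Icc_subset hX
    have hP : Icc xB X ×ˢ Ici (0 : ℝ) ⊆ I ×ˢ Ici (0 : ℝ) := prod_mono hXI subset_rfl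
    exact
      { S_cont := kS.mono hP
        R_cont := kR.mono hP
        Sx_cont := (cSv _).mono hP
        St_cont := (cSv _).mono hP
        Rx_cont := (cRv _).mono hP
        Rt_cont := (cRv _).mono hP
        k_cont := hk.mono hXI
        k_nonneg := fun x hx => hk0 x (hXI hx)
        S_x := fun x hx t ht => (hasDerivWithinAt_slice_x h.S_C1 (hXI hx) ht).mono hXI
        S_t := fun x hx t ht => hasDerivWithinAt_slice_t h.S_C1 (hXI hx) ht
        R_x := fun x hx t ht => (hasDerivWithinAt_slice_x h.R_C1 (hXI hx) ht).mono hXI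
        R_t := fun x hx t ht => hasDerivWithinAt_slice_t h.R_C1 (hXI hx) ht
        S_eq := fun x hx t ht => eS (show (x, t) ∈ I ×ˢ Ici (0 : ℝ) from ⟨hXI hx, ht⟩)
        R_eq := fun x hx t ht => eR (show (x, t) ∈ I ×ˢ Ici (0 : ℝ) from ⟨hXI hx, ht⟩) }

/-! ### Consequences of the slope conditions and of small `ξ` -/

theorem expB_neg {γ : ℝ} (hγ1 : 1 < γ) (hγ3 : γ < 3) : expB γ < 0 := by
  unfold expB
  exact neg_neg_of_pos (div_pos (by linarith) (by linarith))

theorem shape_nonneg {I : Set ℝ} {a : ℝ → ℝ} (ha : IsDivergentDuct I a) {x : ℝ} (hx : x ∈ I) :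
    0 ≤ shape I a x := div_nonneg (ha.deriv_nonneg x hx) (ha.pos x hx).le

/-- The weight that controls every `ξ`-correction in the slope conditions. -/
noncomputable def slopeWeight (γ : ℝ) : ℝ :=
  -- The summand `3` absorbs `2 ξ + ξ ^ 2 ≤ 3 ξ` from the source. If `expB γ = -1`, both quotients
  -- are divisions by zero, hence `0`, and the weight is `3`.
  3 + |1 / (expB γ + 1)| + |(1 - expB γ) / (2 * (expB γ + 1) * (1 - 2 * expB γ))|

theorem slopeWeight_pos (γ : ℝ) : 0 < slopeWeight γ := by
  unfold slopeWeight; positivity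

theorem eq_mul_one_add_xi {S R : ℝ} (hS : 0 < S) : R = S * (1 + xi S R) := by
  unfold xi
  field_simp
  ring

theorem xi_pos {S R : ℝ} (hS : 0 < S) (hR : S < R) : 0 < xi S R := by
  unfold xi
  rw [sub_pos, lt_div_iff₀ hS]
  linarith

/-- The slope condition makes `S₀` nonincreasing in time initially. -/
theorem source_le_of_slope {γ κ S R D : ℝ} (hγ1 : 1 < γ) (hγ3 : γ < 3) (hκ : 0 ≤ κ)
    (hS : 0 < S) (hR : S < R) (h1 : xi S R ≤ 1)
    (hξ : xi S R * slopeWeight γ ≤ 1 / (-expB γ) / 2) (hε : eps S R ≤ 0)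
    (hne : expB γ ≠ -1 →
      κ * S / 2 * (1 / (-expB γ) - 1 / (expB γ + 1) * xi S R) ≤ D)
    (heq : expB γ = -1 → κ * S / 2 * (1 - eps S R * xi S R) ≤ D) :
    source γ κ S R ≤ speed1 γ S R * D := by
  have hξ0 := xi_pos hS hR
  set ξ := xi S R with hξd
  set q := 1 / (-expB γ) with hq
  have hq0 : 0 < q := one_div_pos.2 (neg_pos.2 (expB_neg hγ1 hγ3))
  have hκS : 0 ≤ κ * S / 2 := by positivity
  have habs : (1 / (expB γ + 1)) * ξ ≤ q / 2 - 3 * ξ := by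
    unfold slopeWeight at hξ
    have e1 := mul_le_mul_of_nonneg_right (le_abs_self (1 / (expB γ + 1))) hξ0.le
    have e2 := mul_nonneg hξ0.le
      (abs_nonneg ((1 - expB γ) / (2 * (expB γ + 1) * (1 - 2 * expB γ))))
    linarith
  have h3ξ : 3 * ξ ≤ q / 2 := by
    unfold slopeWeight at hξ
    have e1 := mul_nonneg hξ0.le (abs_nonneg (1 / (expB γ + 1)))
    have e2 := mul_nonneg hξ0.le
      (abs_nonneg ((1 - expB γ) / (2 * (expB γ + 1) * (1 - 2 * expB γ))))
    linarith
  -- The corrections cost at most half of the leading term `q`. In the logarithmic case `eps ≤ 0`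
  -- makes the correction favourable.
  have hD : κ * S / 2 * (q / 2) ≤ D := by
    by_cases hb : expB γ = -1
    · refine (mul_le_mul_of_nonneg_left ?_ hκS).trans (heq hb)
      have : q = 1 := by rw [hq, hb]; norm_num
      rw [this]
      nlinarith [mul_nonneg (neg_nonneg.2 hε) hξ0.le]
    · refine (mul_le_mul_of_nonneg_left ?_ hκS).trans (hne hb)
      linarith
  have hD0 : 0 ≤ D := (mul_nonneg hκS (by positivity)).trans hD
  have hsp : S * D ≤ speed1 γ S R * D := by
    apply mul_le_mul_of_nonneg_right _ hD0
    unfold speed1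
    linarith [mul_nonneg (show 0 ≤ (3 - γ) / 4 by linarith) (sub_nonneg.2 hR.le)]
  refine le_trans ?_ hsp
  refine le_trans ?_ (mul_le_mul_of_nonneg_left hD hS.le)
  have hRe : R = S * (1 + ξ) := eq_mul_one_add_xi hS
  have e : source γ κ S R = (κ * S ^ 2) * ((γ - 1) / 8 * (2 * ξ + ξ ^ 2)) := by
    unfold source; rw [hRe]; ring
  have e' : S * (κ * S / 2 * (q / 2)) = (κ * S ^ 2) * (q / 4) := by ring
  rw [e, e']
  apply mul_le_mul_of_nonneg_left _ (by positivity)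
  have h4 : 2 * ξ + ξ ^ 2 ≤ 3 * ξ := by nlinarith
  have h5 := mul_le_mul (show (γ - 1) / 8 ≤ 1 / 4 by linarith) h4 (by positivity) (by norm_num)
  linarith

/-- The slope condition at the boundary is a Riccati inequality for `S_B`. -/
theorem le_neg_sq_of_slope {γ κ S R D : ℝ} (hκ : 0 ≤ κ)
    (hS : 0 < S) (hR : S < R) (h1 : xi S R ≤ 1)
    (hξ : xi S R * slopeWeight γ ≤ 1 / (-expB γ) / 2) (hε : eps S R ≤ 0)
    (hne : expB γ ≠ -1 → D ≤ κ * S ^ 2 / 2 * (1 / expB γ + 1 / (expB γ + 1) * xi S R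
      + (1 - expB γ) / (2 * (expB γ + 1) * (1 - 2 * expB γ)) * xi S R ^ 2))
    (heq : expB γ = -1 → D ≤ κ * S ^ 2 / 2 * (-1 + eps S R * xi S R
      + (2 * eps S R + 1) / 6 * xi S R ^ 2)) :
    D ≤ -(κ / 4 * (1 / (-expB γ))) * S ^ 2 := by
  have hξ0 := xi_pos hS hR
  set ξ := xi S R with hξd
  set q := 1 / (-expB γ) with hq
  have hξ2 : ξ ^ 2 ≤ ξ := by nlinarith
  have hκS : 0 ≤ κ * S ^ 2 / 2 := by positivity
  have e : -(κ / 4 * q) * S ^ 2 = κ * S ^ 2 / 2 * (-(q / 2)) := by ring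
  rw [e]
  by_cases hb : expB γ = -1
  · refine (heq hb).trans (mul_le_mul_of_nonneg_left ?_ hκS)
    have : q = 1 := by rw [hq, hb]; norm_num
    rw [this]
    nlinarith [mul_nonneg (neg_nonneg.2 hε) hξ0.le, mul_nonneg (neg_nonneg.2 hε) (sq_nonneg ξ)]
  · refine (hne hb).trans (mul_le_mul_of_nonneg_left ?_ hκS)
    have hq' : 1 / expB γ = -q := by rw [hq, one_div_neg_eq_neg_one_div, neg_neg]
    rw [hq']
    unfold slopeWeight at hξ
    have e1 := mul_le_mul_of_nonneg_right (le_abs_self (1 / (expB γ + 1))) hξ0.le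
    have e2 := mul_le_mul_of_nonneg_right
      (le_abs_self ((1 - expB γ) / (2 * (expB γ + 1) * (1 - 2 * expB γ)))) (sq_nonneg ξ)
    have e3 := mul_le_mul_of_nonneg_left hξ2
      (abs_nonneg ((1 - expB γ) / (2 * (expB γ + 1) * (1 - 2 * expB γ))))
    linarith

theorem eps_nonpos {S R : ℝ} (hS : 0 < S) (hR : S < R) (h : S * xi S R ≤ 1) : eps S R ≤ 0 :=
  Real.log_nonpos (mul_pos hS (xi_pos hS hR)).le h

/-- The power `(γ - 1) / 2` undoes the exponent of `R - S`, so this quantity is linear in the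
invariants and inherits their rate. -/
theorem density_rpow {γ ν S R : ℝ} (hγ1 : 1 < γ) (hν : 0 < ν) (hSR : S ≤ R) :
    density γ ν S R ^ ((γ - 1) / 2) = ((γ - 1) / (16 * ν)) ^ (1 / 2 : ℝ) * (R - S) := by
  have h1 : 0 ≤ (γ - 1) / (16 * ν) := div_nonneg (by linarith) (by linarith)
  have hg : γ - 1 ≠ 0 := by linarith
  unfold density
  rw [Real.mul_rpow (Real.rpow_nonneg h1 _) (Real.rpow_nonneg (sub_nonneg.2 hSR) _),
    ← Real.rpow_mul h1, ← Real.rpow_mul (sub_nonneg.2 hSR)]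
  have e1 : 1 / (γ - 1) * ((γ - 1) / 2) = 1 / 2 := by field_simp
  have e2 : 2 / (γ - 1) * ((γ - 1) / 2) = 1 := by field_simp
  rw [e1, e2, Real.rpow_one]

theorem tendstoUniformlyOn_zero_of_le {F : ℝ → ℝ → ℝ} {s : Set ℝ} {φ : ℝ → ℝ}
    (hφ : Tendsto φ atTop (𝓝 0)) (h : ∀ x ∈ s, ∀ t : ℝ, 1 ≤ t → |F t x| ≤ φ t) :
    TendstoUniformlyOn F (fun _ => 0) atTop s := by
  rw [Metric.tendstoUniformlyOn_iff]
  intro ε hε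
  filter_upwards [hφ.eventually_lt_const hε, eventually_ge_atTop 1] with t ht h1 x hx
  rw [dist_zero_left, Real.norm_eq_abs]
  exact (h x hx t h1).trans_lt ht

theorem isBigO_one_div_of_le {f : ℝ → ℝ} {K : ℝ} (h : ∀ t : ℝ, 1 ≤ t → |f t| ≤ K / t) :
    f =O[atTop] (fun t : ℝ => 1 / t) := by
  refine IsBigO.of_bound K ?_
  filter_upwards [eventually_ge_atTop 1] with t ht
  rw [Real.norm_eq_abs, Real.norm_eq_abs, abs_of_pos (one_div_pos.2 (one_pos.trans_le ht)),
    mul_one_div]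
  exact h t ht

/-- The data conditions in the form in which they are used: smallness of `ξ` and sign of `ε`. -/
theorem xi_small {γ C M ν θ S R : ℝ} (hν : √ν ≤ θ / ((|C| + 1) * (|M| + 1))) (hθ1 : θ ≤ 1)
    (hθ : θ * slopeWeight γ ≤ 1 / (-expB γ) / 2) (hS : 0 < S) (hR : S < R) (hM : R ≤ M)
    (hξ : xi S R ≤ C * √ν) :
    xi S R ≤ 1 ∧ xi S R * slopeWeight γ ≤ 1 / (-expB γ) / 2 ∧ eps S R ≤ 0 := by
  have hC : 0 < (|C| + 1) * (|M| + 1) := by positivity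
  rw [le_div_iff₀ hC] at hν
  have h0 := Real.sqrt_nonneg ν
  have hξ0 := xi_pos hS hR
  have h1 : xi S R ≤ |C| * √ν := hξ.trans (mul_le_mul_of_nonneg_right (le_abs_self C) h0)
  -- The factor `|M| + 1` also gives `S * xi S R ≤ 1`, hence the sign of the logarithm.
  have h2 : xi S R * (|M| + 1) ≤ θ := by
    refine le_trans ?_ hν
    have := mul_le_mul_of_nonneg_right (show xi S R ≤ √ν * (|C| + 1) by linarith)
      (show 0 ≤ |M| + 1 by positivity)
    linarith
  have h3 : xi S R ≤ θ := by linarith [mul_nonneg hξ0.le (abs_nonneg M)]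
  refine ⟨h3.trans hθ1, (mul_le_mul_of_nonneg_right h3 (slopeWeight_pos γ).le).trans hθ,
    eps_nonpos hS hR ?_⟩
  have := mul_le_mul_of_nonneg_right (show S ≤ |M| + 1 by linarith [le_abs_self M]) hξ0.le
  linarith

end DuctFlow

/-! ### Assembly -/

namespace DuctFlow

/-- The smallness of `ν` that makes all slope corrections harmless. -/
theorem exists_viscosity_threshold (γ C M : ℝ) (hγ1 : 1 < γ) (hγ3 : γ < 3) :
    ∃ νs : ℝ, 0 < νs ∧ ∀ ν : ℝ, ν ≤ νs → ∀ S R : ℝ, 0 < S → S < R → R ≤ M →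
      xi S R ≤ C * √ν →
      xi S R ≤ 1 ∧ xi S R * slopeWeight γ ≤ 1 / (-expB γ) / 2 ∧ eps S R ≤ 0 := by
  have hw := slopeWeight_pos γ
  have hq : 0 < 1 / (-expB γ) / 2 :=
    half_pos (one_div_pos.2 (neg_pos.2 (expB_neg hγ1 hγ3)))
  set θ := min 1 (1 / (-expB γ) / 2 / slopeWeight γ)
  have hθ : 0 < θ := lt_min one_pos (div_pos hq hw)
  refine ⟨(θ / ((|C| + 1) * (|M| + 1))) ^ 2, by positivity, fun ν hν S R hS hR hM hξ => ?_⟩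
  refine xi_small (θ := θ) ?_ (min_le_left _ _) ?_ hS hR hM hξ
  · exact Real.sqrt_le_iff.2 ⟨by positivity, hν⟩
  · exact (le_div_iff₀ hw).1 (min_le_right _ _)

/-- Order, monotonicity in time, and decay of the larger Riemann invariant. -/
theorem order_monotone_decay {γ xB C M ν : ℝ} {I : Set ℝ} {k S0 R0 SB RB : ℝ → ℝ}
    {S R : ℝ → ℝ → ℝ} (hγ1 : 1 < γ) (hγ3 : γ < 3) (hI : IsDuctInterval xB I)
    (hk : ContinuousOn k I) (hk0 : ∀ x ∈ I, 0 ≤ k x)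
    (hsmall : ∀ S R : ℝ, 0 < S → S < R → R ≤ M → xi S R ≤ C * √ν →
      xi S R ≤ 1 ∧ xi S R * slopeWeight γ ≤ 1 / (-expB γ) / 2 ∧ eps S R ≤ 0)
    (hd : AdmissibleData γ xB I k ν C M S0 R0 SB RB)
    (h : IsGlobalC1Solution γ xB I k S0 R0 SB RB S R) :
    (∀ x ∈ I, ∀ t ∈ Ici (0 : ℝ), 0 < S x t ∧ S x t < R x t) ∧
    (∀ x ∈ I, AntitoneOn (fun t => S x t) (Ici 0) ∧ AntitoneOn (fun t => R x t) (Ici 0)) ∧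
    (0 < k xB → ∃ Q : ℝ, ∀ x ∈ I, ∀ t : ℝ, 0 < t →
      R x t ≤ (8 / (γ + 1) * (x - xB) + Q) / t) := by
  obtain ⟨Sx, St, Rx, Rt, hini, hbd, hstrip⟩ := h.exists_stripSolution hI hk hk0
  have hUI := hI.uniqueDiffOn
  have hUt := uniqueDiffOn_Ici (0 : ℝ)
  have z : (0 : ℝ) ∈ Ici (0 : ℝ) := mem_Ici.2 le_rfl
  have dS0 : ∀ x ∈ I, derivWithin S0 I x = Sx x 0 := fun x hx =>
    (hini x hx).1.derivWithin (hUI x hx)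
  have dR0 : ∀ x ∈ I, derivWithin R0 I x = Rx x 0 := fun x hx =>
    (hini x hx).2.derivWithin (hUI x hx)
  have dSB : ∀ t ∈ Ici (0 : ℝ), derivWithin SB (Ici 0) t = St xB t := fun t ht =>
    (hbd t ht).1.derivWithin (hUt t ht)
  have dRB : ∀ t ∈ Ici (0 : ℝ), derivWithin RB (Ici 0) t = Rt xB t := fun t ht =>
    (hbd t ht).2.derivWithin (hUt t ht)
  have hpos : ∀ X ∈ I, ∀ x ∈ Icc xB X, ∀ t ∈ Ici (0 : ℝ), 0 < S x t ∧ S x t < R x t := by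
    intro X hX
    refine (hstrip X hX).pos_lt hγ1 hγ3 (hI.le_of_mem hX) (fun x hx => ?_) fun t ht => ?_
    · rw [(h.initial x (hI.Icc_subset hX hx)).1, (h.initial x (hI.Icc_subset hX hx)).2]
      exact hd.initial_pos x (hI.Icc_subset hX hx)
    · rw [(h.boundary t ht).1, (h.boundary t ht).2]
      exact hd.boundary_pos t ht
  have hinit : ∀ x ∈ I, St x 0 ≤ 0 ∧ Rt x 0 ≤ 0 := by
    intro x hx
    have hxx : x ∈ Icc xB x := ⟨hI.le_of_mem hx, le_rfl⟩
    have e1 := (hstrip x hx).S_eq x hxx 0 z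
    have e2 := (hstrip x hx).R_eq x hxx 0 z
    obtain ⟨p1, p2⟩ := hd.initial_pos x hx
    obtain ⟨m1, m2⟩ := hd.initial_mono x hx
    obtain ⟨s1, s2, s3⟩ := hsmall _ _ p1 p2 (hd.initial_le x hx) (hd.initial_xi x hx)
    rw [(h.initial x hx).1, (h.initial x hx).2] at e1 e2
    rw [dR0 x hx] at m2
    -- At `t = 0`, `St = g - λ₁ S₀'` and `Rt = -g - λ₂ R₀'`. Only the first sign needs the
    -- quantitative slope bound.
    have a1 := source_le_of_slope hγ1 hγ3 (hk0 x hx) p1 p2 s1 s2 s3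
      (D := derivWithin S0 I x) (fun hb => hd.initial_slopes.S_ne hb x hx)
      fun hb => hd.initial_slopes.S_eq hb x hx
    rw [dS0 x hx] at a1
    have a2 := source_nonneg hγ1 (hk0 x hx) p1.le p2.le
    have a3 := mul_nonneg (speed2_nonneg hγ1 hγ3 p1.le (p1.trans p2).le) m2
    constructor <;> linarith
  have hbdry : ∀ t ∈ Ici (0 : ℝ), St xB t ≤ 0 ∧ Rt xB t ≤ 0 := by
    intro t ht
    rw [← dSB t ht, ← dRB t ht]
    exact hd.boundary_anti t ht
  refine ⟨fun x hx => hpos x hx x ⟨hI.le_of_mem hx, le_rfl⟩, fun x hx => ?_, fun hkB => ?_⟩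
  · have hxx : x ∈ Icc xB x := ⟨hI.le_of_mem hx, le_rfl⟩
    have hs := hstrip x hx
    have hm := hs.deriv_t_nonpos hγ1 hγ3 (hpos x hx)
      (fun y hy => hinit y (hI.Icc_subset hx hy)) hbdry x hxx
    constructor
    · exact antitoneOn_of_hasDerivWithinAt_nonpos (convex_Ici 0)
        (fun s hs' => (hs.S_t x hxx s hs').continuousWithinAt)
        (fun s hs' => (hs.S_t x hxx s (interior_subset hs')).mono interior_subset)
        fun s hs' => (hm s (interior_subset hs')).1
    · exact antitoneOn_of_hasDerivWithinAt_nonpos (convex_Ici 0)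
        (fun s hs' => (hs.R_t x hxx s hs').continuousWithinAt)
        (fun s hs' => (hs.R_t x hxx s (interior_subset hs')).mono interior_subset)
        fun s hs' => (hm s (interior_subset hs')).2
  · have hq : 0 < 1 / (-expB γ) := one_div_pos.2 (neg_pos.2 (expB_neg hγ1 hγ3))
    set κ := k xB / 4 * (1 / (-expB γ)) with hκd
    have hκ : 0 < κ := by positivity
    have hric := le_div_of_riccati hκ (fun t ht => (hd.boundary_pos t ht).1)
      (fun t ht => (hbd t ht).1) fun t ht => by
        obtain ⟨p1, p2⟩ := hd.boundary_pos t ht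
        obtain ⟨s1, s2, s3⟩ := hsmall _ _ p1 p2 (hd.boundary_le t ht) (hd.boundary_xi t ht)
        rw [← dSB t ht]
        exact le_neg_sq_of_slope hkB.le p1 p2 s1 s2 s3
          (fun hb => hd.boundary_slopes.S_ne hb t ht) fun hb => hd.boundary_slopes.S_eq hb t ht
    have hRB : ∀ t : ℝ, 0 < t → R xB t ≤ 2 / κ / t := by
      intro t ht
      have ht' : t ∈ Ici (0 : ℝ) := mem_Ici.2 ht.le
      obtain ⟨p1, p2⟩ := hd.boundary_pos t ht'
      obtain ⟨s1, -, -⟩ := hsmall _ _ p1 p2 (hd.boundary_le t ht') (hd.boundary_xi t ht')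
      have e1 : R xB t = SB t * (1 + xi (SB t) (RB t)) := by
        rw [(h.boundary t ht').2]; exact eq_mul_one_add_xi p1
      have e2 : 2 / κ / t = 1 / κ / t * 2 := by ring
      rw [e1, e2]
      exact mul_le_mul (hric t ht) (by linarith) (by linarith [xi_pos p1 p2]) (by positivity)
    refine ⟨2 / κ + 1, fun x hx t ht => ?_⟩
    rw [← add_assoc]
    exact (hstrip x hx).le_div_of_boundary hγ1 hγ3 (hpos x hx) (by positivity) hRB x
      ⟨hI.le_of_mem hx, le_rfl⟩ t ht

end DuctFlow

theorem proposition3p3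
    (γ : ℝ) (hγ1 : 1 < γ) (hγ3 : γ < 3)
    (xB : ℝ) (I : Set ℝ) (hI : DuctFlow.IsDuctInterval xB I)
    (a : ℝ → ℝ) (ha : DuctFlow.IsDivergentDuct I a)
    (hk : DuctFlow.BoundedC1On (DuctFlow.shape I a) I)
    (δ : ℝ) (hδ0 : 0 < δ) (hδ2 : δ < 2)
    (hk' : ∀ x ∈ I, derivWithin (DuctFlow.shape I a) I x
      ≤ DuctFlow.shape I a x ^ 2 / ((2 - δ) * DuctFlow.expB γ))
    (C M : ℝ) :
    ∃ νs : ℝ, 0 < νs ∧ ∀ ν : ℝ, 0 < ν → ν ≤ νs →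
      ∀ S0 R0 SB RB : ℝ → ℝ,
        DuctFlow.AdmissibleData γ xB I (DuctFlow.shape I a) ν C M S0 R0 SB RB →
      ∀ S R : ℝ → ℝ → ℝ,
        DuctFlow.IsGlobalC1Solution γ xB I (DuctFlow.shape I a) S0 R0 SB RB S R →
      -- behaviour on the vertical line through a point where `k > 0`
      (∀ x ∈ I, 0 < DuctFlow.shape I a x →
        (AntitoneOn (fun t => S x t) (Ici 0) ∧ Tendsto (fun t => S x t) atTop (𝓝 0)) ∧
        (AntitoneOn (fun t => R x t) (Ici 0) ∧ Tendsto (fun t => R x t) atTop (𝓝 0)) ∧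
        (AntitoneOn (fun t => DuctFlow.velocity (S x t) (R x t)) (Ici 0) ∧
          Tendsto (fun t => DuctFlow.velocity (S x t) (R x t)) atTop (𝓝 0)) ∧
        Tendsto (fun t => DuctFlow.density γ ν (S x t) (R x t)) atTop (𝓝 0) ∧
        (fun t => S x t) =O[atTop] (fun t : ℝ => 1 / t) ∧
        (fun t => R x t) =O[atTop] (fun t : ℝ => 1 / t) ∧
        (fun t => DuctFlow.velocity (S x t) (R x t)) =O[atTop] (fun t : ℝ => 1 / t) ∧
        (fun t => DuctFlow.density γ ν (S x t) (R x t) ^ ((γ - 1) / 2))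
          =O[atTop] (fun t : ℝ => 1 / t)) ∧
      -- uniformity on `[x_B, x_*]` when `k(x_*) > 0`, of the convergences and of the rates
      (∀ xs ∈ I, 0 < DuctFlow.shape I a xs →
        TendstoUniformlyOn (fun t x => S x t) (fun _ => 0) atTop (Icc xB xs) ∧
        TendstoUniformlyOn (fun t x => R x t) (fun _ => 0) atTop (Icc xB xs) ∧
        TendstoUniformlyOn (fun t x => DuctFlow.velocity (S x t) (R x t)) (fun _ => 0)
          atTop (Icc xB xs) ∧
        TendstoUniformlyOn (fun t x => DuctFlow.density γ ν (S x t) (R x t)) (fun _ => 0)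
          atTop (Icc xB xs) ∧
        ∃ K : ℝ, ∀ x ∈ Icc xB xs, ∀ t : ℝ, 1 ≤ t →
          |S x t| ≤ K / t ∧ |R x t| ≤ K / t ∧
          |DuctFlow.velocity (S x t) (R x t)| ≤ K / t ∧
          |DuctFlow.density γ ν (S x t) (R x t) ^ ((γ - 1) / 2)| ≤ K / t) := by
  have hkc : ContinuousOn (DuctFlow.shape I a) I := hk.1.continuousOn
  have hk0 : ∀ x ∈ I, 0 ≤ DuctFlow.shape I a x := fun x hx => DuctFlow.shape_nonneg ha hx
  have hanti : AntitoneOn (DuctFlow.shape I a) I := by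
    -- Since `2 - δ > 0` and `expB γ < 0`, the bound on `k'` is nonpositive.
    refine antitoneOn_of_hasDerivWithinAt_nonpos hI.convex hkc (f' := derivWithin (DuctFlow.shape I a) I)
      (fun x hx => (((hk.1.differentiableOn one_ne_zero) x
        (interior_subset hx)).hasDerivWithinAt).mono interior_subset)
      fun x hx => (hk' x (interior_subset hx)).trans ?_
    exact div_nonpos_of_nonneg_of_nonpos (sq_nonneg _)
      (mul_nonpos_of_nonneg_of_nonpos (by linarith) (DuctFlow.expB_neg hγ1 hγ3).le)
  obtain ⟨νs, hνs, hsmall⟩ := DuctFlow.exists_viscosity_threshold γ C M hγ1 hγ3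
  refine ⟨νs, hνs, fun ν hν hνle S0 R0 SB RB hd S R h => ?_⟩
  obtain ⟨hpos, hmono, hdecay⟩ := DuctFlow.order_monotone_decay hγ1 hγ3 hI hkc hk0
    (hsmall ν hνle) hd h
  set c := ((γ - 1) / (16 * ν)) ^ (1 / 2 : ℝ) with hc
  have hγν : 0 ≤ (γ - 1) / (16 * ν) := div_nonneg (by linarith) (by linarith)
  have hc0 : 0 ≤ c := Real.rpow_nonneg hγν _
  have hrate : ∀ xs ∈ I, 0 < DuctFlow.shape I a xs → ∃ K : ℝ, ∀ x ∈ Icc xB xs, ∀ t : ℝ, 1 ≤ t →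
      |S x t| ≤ K / t ∧ |R x t| ≤ K / t ∧ |DuctFlow.velocity (S x t) (R x t)| ≤ K / t ∧
      |DuctFlow.density γ ν (S x t) (R x t) ^ ((γ - 1) / 2)| ≤ K / t := by
    intro xs hxs hks
    obtain ⟨Q, hQ⟩ := hdecay (hks.trans_le (hanti hI.left_mem hxs (hI.le_of_mem hxs)))
    -- The factor `1` serves `S`, `R` and the velocity, and `c` serves the power of the density,
    -- which equals `c * (R - S)`.
    refine ⟨(1 + c) * (8 / (γ + 1) * (xs - xB) + Q), fun x hx t ht => ?_⟩
    have ht0 : 0 < t := one_pos.trans_le ht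
    have hxI := hI.Icc_subset hxs hx
    obtain ⟨p1, p2⟩ := hpos x hxI t (mem_Ici.2 ht0.le)
    set P := (8 / (γ + 1) * (xs - xB) + Q) / t with hP
    have hRP : R x t ≤ P := by
      refine (hQ x hxI t ht0).trans (div_le_div_of_nonneg_right ?_ ht0.le)
      have : 0 < 8 / (γ + 1) := div_pos (by norm_num) (by linarith)
      nlinarith [hx.2]
    have hK : (1 + c) * (8 / (γ + 1) * (xs - xB) + Q) / t = P + c * P := by
      rw [hP]; ring
    have hcP : 0 ≤ c * P := mul_nonneg hc0 (by linarith)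
    rw [hK, DuctFlow.density_rpow hγ1 hν p2.le, ← hc, abs_of_pos p1, abs_of_pos (p1.trans p2),
      abs_of_nonneg (mul_nonneg hc0 (sub_nonneg.2 p2.le))]
    refine ⟨by linarith, by linarith, ?_, ?_⟩
    · unfold DuctFlow.velocity
      rw [abs_of_pos (by linarith)]
      linarith
    · have := mul_le_mul_of_nonneg_left (show R x t - S x t ≤ P by linarith) hc0
      linarith
  have hdiv : ∀ K : ℝ, Tendsto (fun t : ℝ => K / t) atTop (𝓝 0) := fun K =>
    tendsto_const_nhds.div_atTop tendsto_id
  have hunif : ∀ xs ∈ I, 0 < DuctFlow.shape I a xs →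
      TendstoUniformlyOn (fun t x => S x t) (fun _ => 0) atTop (Icc xB xs) ∧
      TendstoUniformlyOn (fun t x => R x t) (fun _ => 0) atTop (Icc xB xs) ∧
      TendstoUniformlyOn (fun t x => DuctFlow.velocity (S x t) (R x t)) (fun _ => 0)
        atTop (Icc xB xs) ∧
      TendstoUniformlyOn (fun t x => DuctFlow.density γ ν (S x t) (R x t)) (fun _ => 0)
        atTop (Icc xB xs) := by
    intro xs hxs hks
    obtain ⟨K, hK⟩ := hrate xs hxs hks
    refine ⟨DuctFlow.tendstoUniformlyOn_zero_of_le (hdiv K) fun x hx t ht => (hK x hx t ht).1,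
      DuctFlow.tendstoUniformlyOn_zero_of_le (hdiv K) fun x hx t ht => (hK x hx t ht).2.1,
      DuctFlow.tendstoUniformlyOn_zero_of_le (hdiv K) fun x hx t ht => (hK x hx t ht).2.2.1,
      DuctFlow.tendstoUniformlyOn_zero_of_le
        (φ := fun t => ((γ - 1) / (16 * ν)) ^ (1 / (γ - 1)) * (K / t) ^ (2 / (γ - 1))) ?_
        fun x hx t ht => ?_⟩
    · have he : 0 < 2 / (γ - 1) := div_pos two_pos (by linarith)
      have := ((hdiv K).rpow_const (p := 2 / (γ - 1)) (Or.inr he.le)).const_mul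
        (((γ - 1) / (16 * ν)) ^ (1 / (γ - 1)))
      rwa [Real.zero_rpow he.ne', mul_zero] at this
    · obtain ⟨p1, p2⟩ := hpos x (hI.Icc_subset hxs hx) t (mem_Ici.2 (zero_le_one.trans ht))
      have hR := (hK x hx t ht).2.1
      rw [abs_of_pos (p1.trans p2)] at hR
      have hD := sub_nonneg.2 p2.le
      have h1 := Real.rpow_nonneg hγν (1 / (γ - 1))
      unfold DuctFlow.density
      rw [abs_of_nonneg (mul_nonneg h1 (Real.rpow_nonneg hD _))]
      exact mul_le_mul_of_nonneg_left (Real.rpow_le_rpow hD (by linarith)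
        (div_nonneg zero_le_two (by linarith))) h1
  refine ⟨fun x hx hkx => ?_, fun xs hxs hks => ?_⟩
  · have hxx : x ∈ Icc xB x := ⟨hI.le_of_mem hx, le_rfl⟩
    obtain ⟨K, hK⟩ := hrate x hx hkx
    obtain ⟨u1, u2, u3, u4⟩ := hunif x hx hkx
    obtain ⟨m1, m2⟩ := hmono x hx
    -- The pointwise limits are the uniform ones on `[xB, x]`, read at the right end.
    refine ⟨⟨m1, u1.tendsto_at hxx⟩, ⟨m2, u2.tendsto_at hxx⟩, ⟨?_, u3.tendsto_at hxx⟩,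
      u4.tendsto_at hxx,
      DuctFlow.isBigO_one_div_of_le fun t ht => (hK x hxx t ht).1,
      DuctFlow.isBigO_one_div_of_le fun t ht => (hK x hxx t ht).2.1,
      DuctFlow.isBigO_one_div_of_le fun t ht => (hK x hxx t ht).2.2.1,
      DuctFlow.isBigO_one_div_of_le fun t ht => (hK x hxx t ht).2.2.2⟩
    intro s hs t ht hst
    have h1 := m1 hs ht hst
    have h2 := m2 hs ht hst
    simp only [DuctFlow.velocity] at h1 h2 ⊢
    linarith
  · obtain ⟨u1, u2, u3, u4⟩ := hunif xs hxs hks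
    exact ⟨u1, u2, u3, u4, hrate xs hxs hks⟩
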